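/- Let $M$ be a $C^\infty$ manifold of dimension $n$, and let $U\subset TM\setminus 0$ be an open set that is invariant under $(x,y)\mapsto(x,cy)$ for all $c>0$ and meets every tangent space (for instance $U=TM\setminus 0$). A Finsler function on $U$ is a smooth function $L:U\to(0,\infty)$ with $L(x,cy)=cL(x,y)$ for $c>0$ whose metric tensor $g_{ij}=\tfrac12\,\dot\partial_i\dot\partial_jL^2$ is nondegenerate on $U$, where $\partial_i=\partial/\partial x^i$ and $\dot\partial_i=\partial/\partial y^i$. In local coordinates put $$\gamma^i_{jk}=\tfrac12g^{ir}(\partial_jg_{kr}+\partial_kg_{jr}-\partial_rg_{jk}),\quad G^i=\tfrac12\gamma^i_{jk}y^jy^k,\quad N^i_j=\dot\partial_jG^i,\quad \delta_i=\partial_i-N^r_i\dot\partial_r,$$ $$\Gamma^i_{jk}=\tfrac12g^{ir}(\delta_jg_{kr}+\delta_kg_{jr}-\delta_rg_{jk}),$$ so that $\Gamma^i_{jk}$ are the horizontal coefficients of the Cartan connection of $L$. A one-form with components $b_i(x)$ is called Cartan-parallel if $b_{i|j}:=\delta_jb_i-b_r\Gamma^r_{ij}=0$ on $U$. Let $L$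 be a Finsler function on $U$, $\sigma$ a smooth function on $M$, $\beta=b_i(x)y^i$ a smooth one-form on $M$, and $f$ a smooth function, positively homogeneous of degree one, on an open cone $\Omega\subset\mathbb R^2$ (that is, $c\,\Omega\subset\Omega$ for $c>0$) that contains all the values $(e^{\sigma}L,\beta)$ on $U$. Assume that $\overline L=f(e^{\sigma}L,\beta)$ (a generalized $\beta$-conformal change of $L$) is again a Finsler function on $U$, let $\overline\Gamma^i_{jk}$ be the horizontal coefficients of its Cartan connection, and let $D^i_{jk}=\overline\Gamma^i_{jk}-\Gamma^i_{jk}$ be the difference tensor. The function $\sigma$ is called homothetic if $\sigma_i:=\partial_i\sigma=0$ everywhere (i.e. $\sigma$ is locally constant). **(a)** If the change is a conformal change ($\beta=0$), then $D^i_{jk}$ vanishes identically on $U$ if and only if $\sigma$ is homothetic. **(b)** Let the change be a $\beta$-change ($\sigma=0$). If $b_i$ is Cartan-parallel, then $D^i_{jk}$ vanishes identically on $U$. If moreover $f$ really depends on $\beta$, in the sense that $\partial f/\partial\beta$ (the partial derivative of $f$ in its second argument) vanishes identically on no nonempty open subset of $\Omega$, then $D^i_{jk}$ vanishes identically on $U$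 if and only if $b_i$ is Cartan-parallel. -/

import Mathlib

open scoped Manifold ContDiff

noncomputable section

namespace FinslerChange

/-! ### Finsler geometry in local coordinates

Geometric objects are functions `F x y` of the position `x` and the supporting element `y`,
both given by their coordinates in `ℝⁿ`. -/

/-- The coordinate space `ℝⁿ`. -/
abbrev Coord (n : ℕ) : Type := EuclideanSpace ℝ (Fin n)

variable {n : ℕ}

/-- The `i`-th coordinate vector. -/
def basisVec (i : Fin n) : Coord n := EuclideanSpace.single i 1

/-- Partial differentiation `∂ᵢ` with respect to `xⁱ`. -/
def pdx (i : Fin n) (F : Coord n → Coord n → ℝ) (x y : Coord n) : ℝ :=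
  fderiv ℝ (fun z => F z y) x (basisVec i)

/-- Partial differentiation with respect to `yⁱ`. -/
def pdy (i : Fin n) (F : Coord n → Coord n → ℝ) (x y : Coord n) : ℝ :=
  fderiv ℝ (fun z => F x z) y (basisVec i)

/-- The Finsler metric tensor `g_ij`: half of the `y`-Hessian of `L²`. -/
def metric (L : Coord n → Coord n → ℝ) (i j : Fin n) : Coord n → Coord n → ℝ :=
  fun x y => (1 / 2) * pdy i (pdy j (fun x' y' => L x' y' ^ 2)) x y

/-- The matrix of the Finsler metric tensor. -/
def metricMatrix (L : Coord n → Coord n → ℝ) (x y : Coord n) : Matrix (Fin n) (Fin n) ℝ :=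
  Matrix.of fun i j => metric L i j x y

/-- The inverse metric `g^ij`. -/
def metricInv (L : Coord n → Coord n → ℝ) (i j : Fin n) (x y : Coord n) : ℝ :=
  (metricMatrix L x y)⁻¹ i j

/-- The Christoffel symbols `γ^i_jk` with respect to `∂ᵢ`. -/
def christoffel (L : Coord n → Coord n → ℝ) (i j k : Fin n) (x y : Coord n) : ℝ :=
  (1 / 2) * ∑ r, metricInv L i r x y *
    (pdx j (metric L k r) x y + pdx k (metric L j r) x y - pdx r (metric L j k) x y)

/-- The canonical spray `G^h = (1/2) γ^h_ij y^i y^j`. -/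
def spray (L : Coord n → Coord n → ℝ) (h : Fin n) (x y : Coord n) : ℝ :=
  (1 / 2) * ∑ i, ∑ j, christoffel L h i j x y * y i * y j

/-- The Barthel (Cartan nonlinear) connection `N^i_j`, the `y^j`-derivative of `G^i`. -/
def barthel (L : Coord n → Coord n → ℝ) (i j : Fin n) : Coord n → Coord n → ℝ :=
  pdy j (spray L i)

/-- The horizontal basis vector fields `δ_i = ∂_i - N^r_i ∂/∂y^r`. -/
def delta (L : Coord n → Coord n → ℝ) (i : Fin n) (F : Coord n → Coord n → ℝ)
    (x y : Coord n) : ℝ :=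
  pdx i F x y - ∑ r, barthel L r i x y * pdy r F x y

/-- The horizontal coefficients `Γ^i_jk` of the Cartan connection: the Christoffel symbols
with respect to `δ_i`. -/
def cartanGamma (L : Coord n → Coord n → ℝ) (i j k : Fin n) (x y : Coord n) : ℝ :=
  (1 / 2) * ∑ r, metricInv L i r x y *
    (delta L j (metric L k r) x y + delta L k (metric L j r) x y - delta L r (metric L j k) x y)

/-- The horizontal Cartan covariant derivative `A_{i|j} = δ_j A_i - A_r Γ^r_ij` of a covector
field. -/
def hCov (L : Coord n → Coord n → ℝ) (A : Fin n → Coord n → Coord n → ℝ) (i j : Fin n)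
    (x y : Coord n) : ℝ :=
  delta L j (A i) x y - ∑ r, A r x y * cartanGamma L r i j x y

/-- The difference tensor `D^i_jk` of the Cartan connections of `L` and `L'`. -/
def difference (L L' : Coord n → Coord n → ℝ) (i j k : Fin n) (x y : Coord n) : ℝ :=
  cartanGamma L' i j k x y - cartanGamma L i j k x y

/-! ### Finsler structures on a manifold -/

variable {M : Type*} [TopologicalSpace M] [ChartedSpace (Coord n) M]

/-- The tangent vector of `M` with coordinates `(x, y)` in the chart `e`. -/
def lift (e : OpenPartialHomeomorph M (Coord n)) (x y : Coord n) : TangentBundle (𝓡 n) M :=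
  tangentMap (𝓡 n) (𝓡 n) e.symm (⟨x, y⟩ : TangentBundle (𝓡 n) (Coord n))

/-- The expression in the chart `e` of a function on the tangent bundle. -/
def inChart (e : OpenPartialHomeomorph M (Coord n)) (F : TangentBundle (𝓡 n) M → ℝ) :
    Coord n → Coord n → ℝ :=
  fun x y => F (lift e x y)

/-- The coordinates `(x, y)` in the chart `e` of the tangent vectors that belong to `U`. -/
def chartDomain (e : OpenPartialHomeomorph M (Coord n)) (U : Set (TangentBundle (𝓡 n) M)) :
    Set (Coord n × Coord n) :=
  {p | p.1 ∈ e.target ∧ lift e p.1 p.2 ∈ U}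

/-- An open cone bundle of nonzero tangent vectors, with nonempty fibres; the slit tangent
bundle of a manifold of positive dimension is the largest one. -/
structure IsConicDomain [IsManifold (𝓡 n) ∞ M] (U : Set (TangentBundle (𝓡 n) M)) : Prop where
  isOpen : IsOpen U
  ne_zero : ∀ v ∈ U, v.2 ≠ 0
  smul_mem : ∀ v ∈ U, ∀ c : ℝ, 0 < c → (⟨v.1, c • v.2⟩ : TangentBundle (𝓡 n) M) ∈ U
  nonempty : ∀ x : M, ∃ y : TangentSpace (𝓡 n) x, (⟨x, y⟩ : TangentBundle (𝓡 n) M) ∈ U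

/-- `L` is a smooth Finsler fundamental function on `U`. Of the metric tensor only
nondegeneracy is required, so that positive definite metrics are included. -/
structure IsFinsler [IsManifold (𝓡 n) ∞ M] (U : Set (TangentBundle (𝓡 n) M))
    (L : TangentBundle (𝓡 n) M → ℝ) : Prop where
  smooth : ContMDiffOn (𝓡 n).tangent 𝓘(ℝ, ℝ) ∞ L U
  pos : ∀ v ∈ U, 0 < L v
  homogeneous : ∀ v ∈ U, ∀ c : ℝ, 0 < c → L ⟨v.1, c • v.2⟩ = c * L v
  nondegenerate : ∀ e ∈ IsManifold.maximalAtlas (𝓡 n) ∞ M, ∀ p ∈ chartDomain e U,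
    (metricMatrix (inChart e L) p.1 p.2).det ≠ 0

/-- The function `β(x, y) = b_i(x) y^i` on the tangent bundle given by a one-form `b`. -/
def betaFun (b : ∀ x : M, TangentSpace (𝓡 n) x →L[ℝ] ℝ) : TangentBundle (𝓡 n) M → ℝ :=
  fun v => b v.1 v.2

/-- The components `b_i` of a one-form in the chart `e`, as functions of `(x, y)` that do not
depend on `y`. -/
def formComp (e : OpenPartialHomeomorph M (Coord n))
    (b : ∀ x : M, TangentSpace (𝓡 n) x →L[ℝ] ℝ) (i : Fin n) : Coord n → Coord n → ℝ :=
  fun x _ => betaFun b (lift e x (basisVec i))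

/-- The generalized `β`-conformal change `f(e^σ L, β)` of `L`. -/
def genChange (f : ℝ × ℝ → ℝ) (σ : M → ℝ) (b : ∀ x : M, TangentSpace (𝓡 n) x →L[ℝ] ℝ)
    (L : TangentBundle (𝓡 n) M → ℝ) : TangentBundle (𝓡 n) M → ℝ :=
  fun v => f (Real.exp (σ v.1) * L v, betaFun b v)

/-- `f` is smooth and positively homogeneous of degree one on the open cone `Ω` of the plane. -/
structure IsChangeFunction (Ω : Set (ℝ × ℝ)) (f : ℝ × ℝ → ℝ) : Prop where
  isOpen : IsOpen Ω
  smul_mem : ∀ p ∈ Ω, ∀ c : ℝ, 0 < c → c • p ∈ Ω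
  smooth : ContDiffOn ℝ ∞ f Ω
  homogeneous : ∀ p ∈ Ω, ∀ c : ℝ, 0 < c → f (c • p) = c * f p

/-- `f` really depends on its second argument: `∂f/∂β` vanishes identically on no nonempty
open subset of `Ω`. -/
def DependsOnBeta (Ω : Set (ℝ × ℝ)) (f : ℝ × ℝ → ℝ) : Prop :=
  ∀ V : Set (ℝ × ℝ), IsOpen V → V ⊆ Ω → V.Nonempty → ∃ p ∈ V, fderiv ℝ f p (0, 1) ≠ 0

/-- The difference tensor of the Cartan connections of `L` and `L'` vanishes identically
on `U`. -/
def DifferenceVanishes (U : Set (TangentBundle (𝓡 n) M))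
    (L L' : TangentBundle (𝓡 n) M → ℝ) : Prop :=
  ∀ e ∈ IsManifold.maximalAtlas (𝓡 n) ∞ M, ∀ p ∈ chartDomain e U, ∀ i j k : Fin n,
    difference (inChart e L) (inChart e L') i j k p.1 p.2 = 0

/-- `b` is Cartan-parallel: `b_{i|j} = 0` on `U` for the Cartan connection of `L`. -/
def CartanParallel (U : Set (TangentBundle (𝓡 n) M))
    (L : TangentBundle (𝓡 n) M → ℝ) (b : ∀ x : M, TangentSpace (𝓡 n) x →L[ℝ] ℝ) : Prop :=
  ∀ e ∈ IsManifold.maximalAtlas (𝓡 n) ∞ M, ∀ p ∈ chartDomain e U, ∀ i j : Fin n,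
    hCov (inChart e L) (formComp e b) i j p.1 p.2 = 0

/-- `σ` is homothetic: `σ_i = ∂_i σ = 0`, that is `dσ = 0` (`σ` is locally constant). -/
def Homothetic (n : ℕ) {M : Type*} [TopologicalSpace M] [ChartedSpace (Coord n) M]
    (σ : M → ℝ) : Prop :=
  ∀ x : M, mfderiv (𝓡 n) 𝓘(ℝ, ℝ) σ x = 0

end FinslerChange

end

/-! The horizontal Cartan connection of $L$ is recognised by parallelism. It satisfies $L_{|k}=0$
and $g_{ij|k}=0$, the coefficients $\Gamma^i_{jk}$ are symmetric in $j,k$, and the deflection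
vanishes: $\Gamma^i_{jk}y^j=N^i_k$. Hence $\dot\partial_iL$ and $\dot\partial_i\dot\partial_jL$ are
parallel as well.

The converse is `IsLocalFinsler.difference_eq_zero`. If $\overline L$ is horizontally constant for
$L$, contracting $\delta_k\overline L^2=0$ with $y^k$ and differentiating in $y$ gives the equation
that determines the spray of $\overline L$. So the two sprays agree, and with them $N$ and $\delta$.
If moreover $\overline g$ is parallel for $L$, the usual Christoffel computation gives
$\overline\Gamma=\Gamma$.

Sufficiency in (a) and (b) is one argument. When $\sigma$ is homothetic and $b$ parallel, $e^\sigma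
L$ and $\beta$ are parallel together with their $y$-derivatives up to order two (`ParallelJet`). By
the chain rule the $y$-Hessian of $f^2(e^\sigma L,\beta)$ is then parallel, and this is $2\overline
g$ (`difference_eq_zero_of_parallelJet`).

For necessity, $D=0$ makes the sprays $\frac12\Gamma^i_{jk}y^jy^k$ equal, so $\delta$ is common and
both $\overline L$ and $\dot\partial_i\overline L$ are parallel for $L$. In (a), $\overline
L=f(1,0)e^\sigma L$, so $\delta_k e^\sigma=\partial_ke^\sigma=0$. In (b),
$f_\beta\,\delta_k\beta=0$, and where $f_\beta\ne0$ parallelism of $\dot\partial_i\overline L$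
reduces to $f_\beta b_{i|k}=0$. If $b_{i|k}\ne0$ at a point, then $f_\beta=0$ along a whole ball
around it. As $f_\beta$ is homogeneous of degree zero and vanishes on no open set, $\beta/L$ must be
a constant $c$ on that ball. Then $b_i=c\,\dot\partial_iL$, which is parallel: a contradiction. -/

noncomputable section

namespace FinslerChange

variable {n : ℕ}

/-! ### Calculus of functions of position and supporting element -/

/-- Smoothness of `F x y` on a set of pairs `(x, y)`. -/
def SmoothIn (D : Set (Coord n × Coord n)) (F : Coord n → Coord n → ℝ) : Prop :=
  ContDiffOn ℝ ∞ (fun p : Coord n × Coord n => F p.1 p.2) D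

/-- The derivative of `F x y` in the direction `v` of the `(x, y)`-space. -/
def dirDeriv (v : Coord n × Coord n) (F : Coord n → Coord n → ℝ) (x y : Coord n) : ℝ :=
  fderiv ℝ (fun p : Coord n × Coord n => F p.1 p.2) (x, y) v

variable {D : Set (Coord n × Coord n)} {F H : Coord n → Coord n → ℝ} {x y : Coord n}

theorem SmoothIn.differentiableAt (hF : SmoothIn D F) (hD : IsOpen D) (hp : (x, y) ∈ D) :
    DifferentiableAt ℝ (fun p : Coord n × Coord n => F p.1 p.2) (x, y) :=
  (hF.contDiffAt (hD.mem_nhds hp)).differentiableAt (by simp)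

theorem SmoothIn.congr (hF : SmoothIn D F) (h : ∀ x y, (x, y) ∈ D → H x y = F x y) :
    SmoothIn D H :=
  ContDiffOn.congr hF fun p hp => h p.1 p.2 hp

theorem SmoothIn.mono {D' : Set (Coord n × Coord n)} (hF : SmoothIn D F) (h : D' ⊆ D) :
    SmoothIn D' F :=
  ContDiffOn.mono hF h

theorem SmoothIn.const (c : ℝ) : SmoothIn D fun _ _ => c := contDiffOn_const

theorem SmoothIn.coord (i : Fin n) : SmoothIn D fun _ y => y i := by
  unfold SmoothIn; fun_prop

theorem SmoothIn.add (hF : SmoothIn D F) (hH : SmoothIn D H) :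
    SmoothIn D fun x y => F x y + H x y := ContDiffOn.add hF hH

theorem SmoothIn.sub (hF : SmoothIn D F) (hH : SmoothIn D H) :
    SmoothIn D fun x y => F x y - H x y := ContDiffOn.sub hF hH

theorem SmoothIn.mul (hF : SmoothIn D F) (hH : SmoothIn D H) :
    SmoothIn D fun x y => F x y * H x y := ContDiffOn.mul hF hH

theorem SmoothIn.sq (hF : SmoothIn D F) : SmoothIn D fun x y => F x y ^ 2 :=
  ContDiffOn.pow hF 2

theorem SmoothIn.sum {ι : Type*} [Fintype ι] {F : ι → Coord n → Coord n → ℝ}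
    (hF : ∀ i, SmoothIn D (F i)) : SmoothIn D fun x y => ∑ i, F i x y :=
  ContDiffOn.sum fun i _ => hF i

theorem dirDeriv_congr (hD : IsOpen D) (hp : (x, y) ∈ D)
    (h : ∀ x y, (x, y) ∈ D → F x y = H x y) (v : Coord n × Coord n) :
    dirDeriv v F x y = dirDeriv v H x y := by
  have : (fun p : Coord n × Coord n => F p.1 p.2) =ᶠ[nhds (x, y)] fun p => H p.1 p.2 := by
    filter_upwards [hD.mem_nhds hp] with p hp using h p.1 p.2 hp
  simp only [dirDeriv, this.fderiv_eq]

theorem dirDeriv_const (v : Coord n × Coord n) (c : ℝ) :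
    dirDeriv v (fun _ _ => c) x y = 0 := by
  simp [dirDeriv]

theorem dirDeriv_coord (v : Coord n × Coord n) (i : Fin n) :
    dirDeriv v (fun _ y => y i) x y = v.2 i := by
  have : HasFDerivAt (fun p : Coord n × Coord n => p.2 i)
      ((EuclideanSpace.proj (𝕜 := ℝ) i).comp (ContinuousLinearMap.snd ℝ (Coord n) (Coord n)))
      (x, y) :=
    ((EuclideanSpace.proj (𝕜 := ℝ) i).comp
      (ContinuousLinearMap.snd ℝ (Coord n) (Coord n))).hasFDerivAt
  simp [dirDeriv, this.fderiv]

theorem dirDeriv_add (hD : IsOpen D) (hp : (x, y) ∈ D) (hF : SmoothIn D F) (hH : SmoothIn D H)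
    (v : Coord n × Coord n) :
    dirDeriv v (fun x y => F x y + H x y) x y = dirDeriv v F x y + dirDeriv v H x y := by
  unfold dirDeriv
  rw [fderiv_fun_add (hF.differentiableAt hD hp) (hH.differentiableAt hD hp)]
  rfl

theorem dirDeriv_sub (hD : IsOpen D) (hp : (x, y) ∈ D) (hF : SmoothIn D F) (hH : SmoothIn D H)
    (v : Coord n × Coord n) :
    dirDeriv v (fun x y => F x y - H x y) x y = dirDeriv v F x y - dirDeriv v H x y := by
  unfold dirDeriv
  rw [fderiv_fun_sub (hF.differentiableAt hD hp) (hH.differentiableAt hD hp)]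
  rfl

theorem dirDeriv_mul (hD : IsOpen D) (hp : (x, y) ∈ D) (hF : SmoothIn D F) (hH : SmoothIn D H)
    (v : Coord n × Coord n) :
    dirDeriv v (fun x y => F x y * H x y) x y =
      F x y * dirDeriv v H x y + H x y * dirDeriv v F x y := by
  unfold dirDeriv
  rw [fderiv_fun_mul (hF.differentiableAt hD hp) (hH.differentiableAt hD hp)]
  rfl

theorem dirDeriv_const_mul (hD : IsOpen D) (hp : (x, y) ∈ D) (c : ℝ) (hF : SmoothIn D F)
    (v : Coord n × Coord n) :
    dirDeriv v (fun x y => c * F x y) x y = c * dirDeriv v F x y := by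
  rw [dirDeriv_mul hD hp (SmoothIn.const c) hF, dirDeriv_const]; ring

theorem dirDeriv_sq (hD : IsOpen D) (hp : (x, y) ∈ D) (hF : SmoothIn D F)
    (v : Coord n × Coord n) :
    dirDeriv v (fun x y => F x y ^ 2) x y = 2 * F x y * dirDeriv v F x y := by
  simp only [pow_two]
  rw [dirDeriv_mul hD hp hF hF]; ring

theorem dirDeriv_sum (hD : IsOpen D) (hp : (x, y) ∈ D) {ι : Type*} [Fintype ι]
    {F : ι → Coord n → Coord n → ℝ} (hF : ∀ i, SmoothIn D (F i)) (v : Coord n × Coord n) :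
    dirDeriv v (fun x y => ∑ i, F i x y) x y = ∑ i, dirDeriv v (F i) x y := by
  unfold dirDeriv
  rw [fderiv_fun_sum fun i _ => (hF i).differentiableAt hD hp]
  simp

theorem SmoothIn.dirDeriv (hF : SmoothIn D F) (hD : IsOpen D) (v : Coord n × Coord n) :
    SmoothIn D (dirDeriv v F) :=
  (ContDiffOn.fderiv_of_isOpen hF hD (m := ∞) (by simp)).clm_apply contDiffOn_const

/-- Both iterated derivatives are values of the second Fréchet derivative, which is symmetric. All
exchanges of `pdx` and `pdy` come from here. -/
theorem dirDeriv_comm (hD : IsOpen D) (hp : (x, y) ∈ D) (hF : SmoothIn D F)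
    (v w : Coord n × Coord n) :
    dirDeriv v (dirDeriv w F) x y = dirDeriv w (dirDeriv v F) x y := by
  have hc := hF.contDiffAt (hD.mem_nhds hp)
  have hd : DifferentiableAt ℝ (fderiv ℝ fun p : Coord n × Coord n => F p.1 p.2) (x, y) :=
    (hc.fderiv_right (m := ∞) (by simp)).differentiableAt (by simp)
  have key : ∀ v w, FinslerChange.dirDeriv v (FinslerChange.dirDeriv w F) x y =
      fderiv ℝ (fderiv ℝ fun p : Coord n × Coord n => F p.1 p.2) (x, y) v w := by
    intro v w
    have := (hd.hasFDerivAt.clm_apply (hasFDerivAt_const w (x, y))).fderiv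
    change fderiv ℝ (fun p => fderiv ℝ (fun p : Coord n × Coord n => F p.1 p.2) p w) (x, y) v = _
    rw [this]
    simp
  rw [key, key]
  exact (hc.isSymmSndFDerivAt (by simpa using WithTop.coe_le_coe.2 (le_top : (2 : ℕ∞) ≤ ⊤))).eq v w

theorem pdx_eq_dirDeriv (hD : IsOpen D) (hp : (x, y) ∈ D) (hF : SmoothIn D F) (i : Fin n) :
    pdx i F x y = dirDeriv (basisVec i, 0) F x y := by
  have h := HasFDerivAt.comp (f := fun z => (z, y)) x (hF.differentiableAt hD hp).hasFDerivAt
    (hasFDerivAt_prodMk_left x y)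
  have h' := h.fderiv
  simp only [Function.comp_def] at h'
  simp [pdx, dirDeriv, h']

theorem pdy_eq_dirDeriv (hD : IsOpen D) (hp : (x, y) ∈ D) (hF : SmoothIn D F) (i : Fin n) :
    pdy i F x y = dirDeriv (0, basisVec i) F x y := by
  have h := (hF.differentiableAt hD hp).hasFDerivAt.comp y (hasFDerivAt_prodMk_right x y)
  have h' := h.fderiv
  simp only [Function.comp_def] at h'
  simp [pdy, dirDeriv, h']

theorem SmoothIn.pdx (hF : SmoothIn D F) (hD : IsOpen D) (i : Fin n) : SmoothIn D (pdx i F) :=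
  (hF.dirDeriv hD (basisVec i, 0)).congr fun _ _ hp => pdx_eq_dirDeriv hD hp hF i

theorem SmoothIn.pdy (hF : SmoothIn D F) (hD : IsOpen D) (i : Fin n) : SmoothIn D (pdy i F) :=
  (hF.dirDeriv hD (0, basisVec i)).congr fun _ _ hp => pdy_eq_dirDeriv hD hp hF i

theorem pdy_congr (hD : IsOpen D) (hp : (x, y) ∈ D)
    (h : ∀ x y, (x, y) ∈ D → F x y = H x y) (i : Fin n) : pdy i F x y = pdy i H x y := by
  have hc : Continuous fun z : Coord n => (x, z) := by fun_prop
  have : (fun z => F x z) =ᶠ[nhds y] fun z => H x z := by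
    filter_upwards [hc.continuousAt.preimage_mem_nhds (hD.mem_nhds hp)] with z hz
      using h x z hz
  simp only [pdy, this.fderiv_eq]

/-- The horizontal basis direction `∂_k - N^r_k ∂/∂y^r`. -/
def horizVec (L : Coord n → Coord n → ℝ) (k : Fin n) (x y : Coord n) : Coord n × Coord n :=
  (basisVec k, -∑ r, barthel L r k x y • basisVec r)

theorem horizVec_snd (L : Coord n → Coord n → ℝ) (k i : Fin n) (x y : Coord n) :
    (horizVec L k x y).2 i = -barthel L i k x y := by
  simp [horizVec, basisVec, Pi.single_apply]

/-- At a fixed point $\delta_k$ is differentiation along one vector, so the sum, product and chain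
rules for `dirDeriv` apply to it directly. -/
theorem delta_eq_dirDeriv (L : Coord n → Coord n → ℝ) (hD : IsOpen D) (hp : (x, y) ∈ D)
    (hF : SmoothIn D F) (k : Fin n) : delta L k F x y = dirDeriv (horizVec L k x y) F x y := by
  have : horizVec L k x y = (basisVec k, 0) - ∑ r, barthel L r k x y • (0, basisVec r) := by
    simp [horizVec, Prod.ext_iff, Prod.fst_sum, Prod.snd_sum]
  rw [delta, pdx_eq_dirDeriv hD hp hF, this]
  simp only [pdy_eq_dirDeriv hD hp hF]
  simp only [dirDeriv, map_sub, map_sum, map_smul, smul_eq_mul]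

theorem SmoothIn.delta {L : Coord n → Coord n → ℝ} (hF : SmoothIn D F) (hD : IsOpen D)
    (k : Fin n) (hN : ∀ r, SmoothIn D (barthel L r k)) : SmoothIn D (delta L k F) :=
  (hF.pdx hD k).sub (SmoothIn.sum fun r => (hN r).mul (hF.pdy hD r))

theorem pdy_pdy_comm (hD : IsOpen D) (hp : (x, y) ∈ D) (hF : SmoothIn D F) (i j : Fin n) :
    pdy i (pdy j F) x y = pdy j (pdy i F) x y := by
  rw [pdy_eq_dirDeriv hD hp (hF.pdy hD j), pdy_eq_dirDeriv hD hp (hF.pdy hD i),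
    dirDeriv_congr hD hp fun _ _ hp => pdy_eq_dirDeriv hD hp hF j,
    dirDeriv_comm hD hp hF,
    dirDeriv_congr hD hp fun _ _ hp => pdy_eq_dirDeriv hD hp hF i]

theorem pdx_pdy_comm (hD : IsOpen D) (hp : (x, y) ∈ D) (hF : SmoothIn D F) (i j : Fin n) :
    pdx i (pdy j F) x y = pdy j (pdx i F) x y := by
  rw [pdx_eq_dirDeriv hD hp (hF.pdy hD j), pdy_eq_dirDeriv hD hp (hF.pdx hD i),
    dirDeriv_congr hD hp fun _ _ hp => pdy_eq_dirDeriv hD hp hF j,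
    dirDeriv_comm hD hp hF,
    dirDeriv_congr hD hp fun _ _ hp => pdx_eq_dirDeriv hD hp hF i]

/-! ### Homogeneity in the supporting element -/

/-- `F` is positively homogeneous of degree `k` in `y` on `D`. -/
def HomogIn (D : Set (Coord n × Coord n)) (k : ℕ) (F : Coord n → Coord n → ℝ) : Prop :=
  ∀ x y, (x, y) ∈ D → ∀ c : ℝ, 0 < c → F x (c • y) = c ^ k * F x y

/-- `D` is invariant under positive rescaling of `y`. -/
def ConicIn (D : Set (Coord n × Coord n)) : Prop :=
  ∀ x y, (x, y) ∈ D → ∀ c : ℝ, 0 < c → (x, c • y) ∈ D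

/-- Differentiating $F(x,cy)=c^{k+1}F(x,y)$ in $y$ produces a factor $c$ on the left, which is then
cancelled. -/
theorem HomogIn.pdy {k : ℕ} (hF : HomogIn D (k + 1) F) (hs : SmoothIn D F) (hD : IsOpen D)
    (hC : ConicIn D) (i : Fin n) : HomogIn D k (pdy i F) := by
  intro x y hp c hc
  have hsm : ∀ {z}, (x, z) ∈ D → DifferentiableAt ℝ (fun z => F x z) z := fun {z} hz =>
    ((hs.differentiableAt hD hz).comp z (hasFDerivAt_prodMk_right x z).differentiableAt :)
  have h1 : HasFDerivAt (fun z => F x (c • z))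
      ((fderiv ℝ (fun z => F x z) (c • y)).comp (c • ContinuousLinearMap.id ℝ (Coord n))) y :=
    (hsm (hC x y hp c hc)).hasFDerivAt.comp y ((hasFDerivAt_id y).const_smul c)
  have h2 : HasFDerivAt (fun z => c ^ (k + 1) * F x z)
      (c ^ (k + 1) • fderiv ℝ (fun z => F x z) y) y := (hsm hp).hasFDerivAt.const_mul _
  have hcont : Continuous fun z : Coord n => (x, z) := by fun_prop
  have he : (fun z => F x (c • z)) =ᶠ[nhds y] fun z => c ^ (k + 1) * F x z := by
    filter_upwards [hcont.continuousAt.preimage_mem_nhds (hD.mem_nhds hp)] with z hz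
      using hF x z hz c hc
  have := congrArg (fun T => T (basisVec i)) (h1.unique (h2.congr_of_eventuallyEq he))
  simp only [ContinuousLinearMap.comp_apply, smul_apply,
    ContinuousLinearMap.id_apply, map_smul, smul_eq_mul] at this
  simp only [FinslerChange.pdy]
  have hc' := hc.ne'
  apply mul_left_cancel₀ hc'
  rw [this]; ring

theorem HomogIn.pdx {k : ℕ} (hF : HomogIn D k F) (hs : SmoothIn D F) (hD : IsOpen D)
    (i : Fin n) : HomogIn D k (pdx i F) := by
  intro x y hp c hc
  have hcont : Continuous fun z : Coord n => (z, y) := by fun_prop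
  have he : (fun z => F z (c • y)) =ᶠ[nhds x] fun z => c ^ k * F z y := by
    filter_upwards [hcont.continuousAt.preimage_mem_nhds (hD.mem_nhds hp)] with z hz
      using hF z y hz c hc
  have hd : DifferentiableAt ℝ (fun z => F z y) x :=
    DifferentiableAt.comp (f := fun z => (z, y)) x (hs.differentiableAt hD hp)
      (hasFDerivAt_prodMk_left x y).differentiableAt
  simp only [FinslerChange.pdx, he.fderiv_eq]
  rw [fderiv_const_mul hd]
  simp

theorem sum_smul_basisVec (y : Coord n) : ∑ i, y i • basisVec i = y := by
  ext j; simp [basisVec, Pi.single_apply]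

theorem HomogIn.euler {k : ℕ} (hF : HomogIn D k F) (hs : SmoothIn D F) (hD : IsOpen D)
    (hp : (x, y) ∈ D) : ∑ i, FinslerChange.pdy i F x y * y i = k * F x y := by
  have hd : DifferentiableAt ℝ (fun z => F x z) y :=
    ((hs.differentiableAt hD hp).comp y (hasFDerivAt_prodMk_right x y).differentiableAt :)
  have h0 : HasDerivAt (fun t : ℝ => t • y) y 1 := by
    simpa using (hasDerivAt_id (1 : ℝ)).smul_const y
  have h1 : HasDerivAt (fun t : ℝ => F x (t • y)) (fderiv ℝ (fun z => F x z) y y) 1 := by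
    have : HasFDerivAt (fun z => F x z) (fderiv ℝ (fun z => F x z) y) ((1 : ℝ) • y) := by
      simpa using hd.hasFDerivAt
    exact this.comp_hasDerivAt 1 h0
  have h2 : HasDerivAt (fun t : ℝ => t ^ k * F x y) (k * F x y) 1 := by
    simpa using (hasDerivAt_pow k (1 : ℝ)).mul_const (F x y)
  have he : (fun t : ℝ => F x (t • y)) =ᶠ[nhds 1] fun t => t ^ k * F x y := by
    filter_upwards [lt_mem_nhds (zero_lt_one (α := ℝ))] with t ht using hF x y hp t ht
  rw [← h1.unique (h2.congr_of_eventuallyEq he)]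
  conv_rhs => arg 2; rw [← sum_smul_basisVec y]
  simp [FinslerChange.pdy, mul_comm]

end FinslerChange
end

noncomputable section

namespace FinslerChange

variable {n : ℕ}

/-! ### Finsler functions on a conic domain of coordinate pairs -/

/-- A Finsler function on an open conic set of pairs `(x, y)`. -/
structure IsLocalFinsler (D : Set (Coord n × Coord n)) (L : Coord n → Coord n → ℝ) : Prop where
  isOpen : IsOpen D
  conic : ConicIn D
  smooth : SmoothIn D L
  pos : ∀ x y, (x, y) ∈ D → 0 < L x y
  homog : HomogIn D 1 L
  det_ne_zero : ∀ x y, (x, y) ∈ D → (metricMatrix L x y).det ≠ 0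

/-- The square of `L`. -/
def energy (L : Coord n → Coord n → ℝ) : Coord n → Coord n → ℝ := fun x y => L x y ^ 2

theorem metric_eq (L : Coord n → Coord n → ℝ) (i j : Fin n) :
    metric L i j = fun x y => (1 / 2) * pdy i (pdy j (energy L)) x y := rfl

variable {D : Set (Coord n × Coord n)} {L L' : Coord n → Coord n → ℝ} {x y : Coord n}

theorem SmoothIn.det {m : Type*} [Fintype m] [DecidableEq m]
    {A : m → m → Coord n → Coord n → ℝ} (hA : ∀ i j, SmoothIn D (A i j)) :
    SmoothIn D fun x y => (Matrix.of fun i j => A i j x y).det := by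
  simp only [Matrix.det_apply, Matrix.of_apply, Units.smul_def, zsmul_eq_mul]
  exact SmoothIn.sum fun τ => (SmoothIn.const _).mul
    (contDiffOn_prod fun i _ => hA (τ i) i)

namespace IsLocalFinsler

theorem smooth_energy (H : IsLocalFinsler D L) : SmoothIn D (energy L) := H.smooth.sq

theorem homog_energy (H : IsLocalFinsler D L) : HomogIn D 2 (energy L) := by
  intro x y hp c hc
  simp only [energy, H.homog x y hp c hc]; ring

theorem smooth_pdy_energy (H : IsLocalFinsler D L) (i : Fin n) :
    SmoothIn D (pdy i (energy L)) := H.smooth_energy.pdy H.isOpen i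

theorem homog_pdy_energy (H : IsLocalFinsler D L) (i : Fin n) :
    HomogIn D 1 (pdy i (energy L)) :=
  HomogIn.pdy H.homog_energy H.smooth_energy H.isOpen H.conic i

theorem smooth_metric (H : IsLocalFinsler D L) (i j : Fin n) : SmoothIn D (metric L i j) :=
  (SmoothIn.const _).mul ((H.smooth_pdy_energy j).pdy H.isOpen i)

theorem homog_metric (H : IsLocalFinsler D L) (i j : Fin n) : HomogIn D 0 (metric L i j) := by
  intro x y hp c hc
  have := HomogIn.pdy (H.homog_pdy_energy j) (H.smooth_pdy_energy j) H.isOpen H.conic i x y hp c hc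
  simp only [metric_eq, this]; ring

theorem metric_symm (H : IsLocalFinsler D L) (hp : (x, y) ∈ D) (i j : Fin n) :
    metric L i j x y = metric L j i x y := by
  simp only [metric_eq, pdy_pdy_comm H.isOpen hp H.smooth_energy i j]

theorem sum_metric_mul_metricInv (H : IsLocalFinsler D L) (hp : (x, y) ∈ D) (i j : Fin n) :
    ∑ r, metric L i r x y * metricInv L r j x y = if i = j then 1 else 0 := by
  have h := Matrix.mul_nonsing_inv (metricMatrix L x y) (H.det_ne_zero x y hp).isUnit
  simpa [Matrix.mul_apply, Matrix.one_apply, metricMatrix, metricInv] using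
    congrFun (congrFun h i) j

theorem sum_metricInv_mul_metric (H : IsLocalFinsler D L) (hp : (x, y) ∈ D) (i j : Fin n) :
    ∑ r, metricInv L i r x y * metric L r j x y = if i = j then 1 else 0 := by
  have h := Matrix.nonsing_inv_mul (metricMatrix L x y) (H.det_ne_zero x y hp).isUnit
  simpa [Matrix.mul_apply, Matrix.one_apply, metricMatrix, metricInv] using
    congrFun (congrFun h i) j

/-- Lowering an index that was raised. -/
theorem lower_raise (H : IsLocalFinsler D L) (hp : (x, y) ∈ D) (T : Fin n → ℝ) (r : Fin n) :
    ∑ h, metric L r h x y * ((1 / 2) * ∑ s, metricInv L h s x y * T s) = (1 / 2) * T r := by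
  calc _ = (1 / 2) * ∑ s, (∑ h, metric L r h x y * metricInv L h s x y) * T s := by
        simp only [Finset.mul_sum, Finset.sum_mul]
        rw [Finset.sum_comm]
        refine Finset.sum_congr rfl fun _ _ => Finset.sum_congr rfl fun _ _ => by ring
    _ = _ := by simp [H.sum_metric_mul_metricInv hp]

/-- Raising an index that was lowered. -/
theorem raise_lower (H : IsLocalFinsler D L) (hp : (x, y) ∈ D) (a : Fin n → ℝ) (i : Fin n) :
    ∑ r, metricInv L i r x y * ∑ s, metric L r s x y * a s = a i := by
  calc _ = ∑ s, (∑ r, metricInv L i r x y * metric L r s x y) * a s := by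
        simp only [Finset.mul_sum, Finset.sum_mul]
        rw [Finset.sum_comm]
        refine Finset.sum_congr rfl fun _ _ => Finset.sum_congr rfl fun _ _ => by ring
    _ = _ := by simp [H.sum_metricInv_mul_metric hp]

theorem eq_of_lower_eq (H : IsLocalFinsler D L) (hp : (x, y) ∈ D) {a b : Fin n → ℝ}
    (h : ∀ r, ∑ s, metric L r s x y * a s = ∑ s, metric L r s x y * b s) (i : Fin n) :
    a i = b i := by
  rw [← H.raise_lower hp a i, ← H.raise_lower hp b i]
  simp only [h]

/-- Cramer's rule: the inverse is the adjugate over the nonvanishing determinant, and the adjugate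
entries are themselves determinants. -/
theorem smooth_metricInv (H : IsLocalFinsler D L) (i j : Fin n) :
    SmoothIn D (metricInv L i j) := by
  have h1 : SmoothIn D fun x y => (metricMatrix L x y).det :=
    SmoothIn.det H.smooth_metric
  have h2 : SmoothIn D fun x y => (metricMatrix L x y).adjugate i j := by
    have : ∀ k l, SmoothIn D fun x y =>
        (metricMatrix L x y).updateRow j (Pi.single i 1) k l := by
      intro k l
      by_cases hk : k = j
      · subst hk
        simpa [Matrix.updateRow_self] using SmoothIn.const _
      · simp only [Matrix.updateRow_ne hk]
        exact H.smooth_metric k l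
    simp only [Matrix.adjugate_apply]
    exact SmoothIn.det this
  have h3 : SmoothIn D fun x y => (metricMatrix L x y).det⁻¹ :=
    ContDiffOn.inv h1 fun p hp => H.det_ne_zero p.1 p.2 hp
  refine (h3.mul h2).congr ?_
  intro x y _
  simp [metricInv, Matrix.inv_def, Ring.inverse_eq_inv']

theorem homog_metricInv (H : IsLocalFinsler D L) (i j : Fin n) :
    HomogIn D 0 (metricInv L i j) := by
  intro x y hp c hc
  have : metricMatrix L x (c • y) = metricMatrix L x y := by
    ext k l
    simpa [metricMatrix] using H.homog_metric k l x y hp c hc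
  simp [metricInv, this]

/-- Euler's relation for $\dot\partial_iL^2$, which is homogeneous of degree one. -/
theorem sum_metric_mul_coord (H : IsLocalFinsler D L) (hp : (x, y) ∈ D) (i : Fin n) :
    ∑ j, metric L i j x y * y j = (1 / 2) * pdy i (energy L) x y := by
  have := (H.homog_pdy_energy i).euler (H.smooth_pdy_energy i) H.isOpen hp
  simp only [Nat.cast_one, one_mul] at this
  rw [← this, Finset.mul_sum]
  refine Finset.sum_congr rfl fun j _ => ?_
  rw [H.metric_symm hp, metric_eq]; ring

theorem sum_pdy_energy_mul_coord (H : IsLocalFinsler D L) (hp : (x, y) ∈ D) :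
    ∑ j, pdy j (energy L) x y * y j = 2 * energy L x y := by
  simpa using H.homog_energy.euler H.smooth_energy H.isOpen hp

theorem dirDeriv_metric (H : IsLocalFinsler D L) (hp : (x, y) ∈ D) (i j : Fin n)
    (v : Coord n × Coord n) :
    dirDeriv v (metric L i j) x y = (1 / 2) * dirDeriv v (pdy i (pdy j (energy L))) x y :=
  dirDeriv_const_mul H.isOpen hp _ ((H.smooth_pdy_energy j).pdy H.isOpen i) v

/-- The $y$-derivative of the metric is half a third $y$-derivative of $L^2$, hence totally
symmetric (the Cartan tensor up to a factor). -/
theorem pdy_metric_comm (H : IsLocalFinsler D L) (hp : (x, y) ∈ D) (s j r : Fin n) :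
    pdy s (metric L j r) x y = pdy j (metric L s r) x y := by
  rw [pdy_eq_dirDeriv H.isOpen hp (H.smooth_metric j r),
    pdy_eq_dirDeriv H.isOpen hp (H.smooth_metric s r), H.dirDeriv_metric hp, H.dirDeriv_metric hp,
    ← pdy_eq_dirDeriv H.isOpen hp ((H.smooth_pdy_energy r).pdy H.isOpen j),
    ← pdy_eq_dirDeriv H.isOpen hp ((H.smooth_pdy_energy r).pdy H.isOpen s),
    pdy_pdy_comm H.isOpen hp (H.smooth_pdy_energy r)]

/-- By total symmetry $y$ may be contracted with the derivative index, and $g$ is homogeneous of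
degree zero. -/
theorem sum_pdy_metric_mul_coord (H : IsLocalFinsler D L) (hp : (x, y) ∈ D) (s r : Fin n) :
    ∑ j, pdy s (metric L j r) x y * y j = 0 := by
  simp only [H.pdy_metric_comm hp s]
  simpa using (H.homog_metric s r).euler (H.smooth_metric s r) H.isOpen hp

end IsLocalFinsler

theorem dirDeriv_sum_mul_coord (hD : IsOpen D) (hp : (x, y) ∈ D)
    {F : Fin n → Coord n → Coord n → ℝ} (hF : ∀ i, SmoothIn D (F i)) (v : Coord n × Coord n) :
    dirDeriv v (fun x y => ∑ j, F j x y * y j) x y =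
      ∑ j, dirDeriv v (F j) x y * y j + ∑ j, F j x y * v.2 j := by
  rw [dirDeriv_sum hD hp fun j => (hF j).mul (SmoothIn.coord j), ← Finset.sum_add_distrib]
  refine Finset.sum_congr rfl fun j _ => ?_
  rw [dirDeriv_mul hD hp (hF j) (SmoothIn.coord j), dirDeriv_coord]; ring

/-! ### Contraction identities; the spray, the Barthel connection and the Cartan coefficients. -/

namespace IsLocalFinsler

theorem sum_dirDeriv_metric_mul_coord (H : IsLocalFinsler D L) (hp : (x, y) ∈ D) (i : Fin n)
    (v : Coord n × Coord n) :
    ∑ j, dirDeriv v (metric L i j) x y * y j =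
      (1 / 2) * dirDeriv v (pdy i (energy L)) x y - ∑ j, metric L i j x y * v.2 j := by
  have := dirDeriv_sum_mul_coord H.isOpen hp (H.smooth_metric i) v
  rw [dirDeriv_congr H.isOpen hp (fun _ _ hp => H.sum_metric_mul_coord hp i),
    dirDeriv_const_mul H.isOpen hp _ (H.smooth_pdy_energy i)] at this
  linarith

theorem sum_pdx_metric_mul_coord (H : IsLocalFinsler D L) (hp : (x, y) ∈ D) (i k : Fin n) :
    ∑ j, pdx k (metric L i j) x y * y j = (1 / 2) * pdx k (pdy i (energy L)) x y := by
  simp only [pdx_eq_dirDeriv H.isOpen hp (H.smooth_metric _ _),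
    pdx_eq_dirDeriv H.isOpen hp (H.smooth_pdy_energy _), H.sum_dirDeriv_metric_mul_coord hp]
  simp

theorem pdx_metric_symm (H : IsLocalFinsler D L) (hp : (x, y) ∈ D) (i j k : Fin n) :
    pdx k (metric L i j) x y = pdx k (metric L j i) x y := by
  rw [pdx_eq_dirDeriv H.isOpen hp (H.smooth_metric _ _),
    pdx_eq_dirDeriv H.isOpen hp (H.smooth_metric _ _),
    dirDeriv_congr H.isOpen hp fun _ _ hp => H.metric_symm hp i j]

theorem pdy_metric_symm (H : IsLocalFinsler D L) (hp : (x, y) ∈ D) (i j k : Fin n) :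
    pdy k (metric L i j) x y = pdy k (metric L j i) x y :=
  pdy_congr H.isOpen hp (fun _ _ hp => H.metric_symm hp i j) k

theorem delta_metric_symm (H : IsLocalFinsler D L) (L₀ : Coord n → Coord n → ℝ)
    (hp : (x, y) ∈ D) (i j k : Fin n) :
    delta L₀ k (metric L i j) x y = delta L₀ k (metric L j i) x y := by
  simp only [delta, H.pdx_metric_symm hp i j, H.pdy_metric_symm hp i j]

theorem sum_sum_pdx_metric_mul_coord (H : IsLocalFinsler D L) (hp : (x, y) ∈ D) (k : Fin n) :
    ∑ i, ∑ j, pdx k (metric L i j) x y * y i * y j = pdx k (energy L) x y := by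
  have h1 : ∀ i, ∑ j, pdx k (metric L i j) x y * y i * y j =
      (1 / 2) * (dirDeriv (basisVec k, 0) (pdy i (energy L)) x y * y i) := by
    intro i
    rw [← pdx_eq_dirDeriv H.isOpen hp (H.smooth_pdy_energy _)]
    have := H.sum_pdx_metric_mul_coord hp i k
    calc _ = (∑ j, pdx k (metric L i j) x y * y j) * y i := by
          rw [Finset.sum_mul]; exact Finset.sum_congr rfl fun _ _ => by ring
      _ = _ := by rw [this]; ring
  have h2 := dirDeriv_sum_mul_coord H.isOpen hp H.smooth_pdy_energy (basisVec k, 0)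
  rw [dirDeriv_congr H.isOpen hp (fun _ _ hp => H.sum_pdy_energy_mul_coord hp),
    dirDeriv_const_mul H.isOpen hp _ H.smooth_energy,
    ← pdx_eq_dirDeriv H.isOpen hp H.smooth_energy] at h2
  simp only [PiLp.zero_apply, mul_zero, Finset.sum_const_zero, add_zero] at h2
  simp only [h1, ← Finset.mul_sum]
  linarith

/-- The lowered spray coefficients in terms of the energy. -/
theorem lower_spray (H : IsLocalFinsler D L) (hp : (x, y) ∈ D) (r : Fin n) :
    ∑ h, metric L r h x y * spray L h x y =
      (1 / 4) * (∑ j, pdx j (pdy r (energy L)) x y * y j - pdx r (energy L) x y) := by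
  have h1 : ∀ i j, ∑ h, metric L r h x y * christoffel L h i j x y = (1 / 2) *
      (pdx i (metric L j r) x y + pdx j (metric L i r) x y - pdx r (metric L i j) x y) :=
    fun i j => H.lower_raise hp
      (fun r => pdx i (metric L j r) x y + pdx j (metric L i r) x y - pdx r (metric L i j) x y) r
  have h2 : ∑ h, metric L r h x y * spray L h x y =
      (1 / 2) * ∑ i, ∑ j, (∑ h, metric L r h x y * christoffel L h i j x y) * y i * y j := by
    simp only [spray, Finset.mul_sum, Finset.sum_mul]
    rw [Finset.sum_comm]
    refine Finset.sum_congr rfl fun i _ => ?_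
    rw [Finset.sum_comm]
    refine Finset.sum_congr rfl fun _ _ => Finset.sum_congr rfl fun _ _ => by ring
  have h3 : ∑ i, ∑ j, pdx i (metric L j r) x y * y i * y j =
      (1 / 2) * ∑ j, pdx j (pdy r (energy L)) x y * y j := by
    rw [Finset.mul_sum]
    refine Finset.sum_congr rfl fun i _ => ?_
    rw [← mul_assoc, ← H.sum_pdx_metric_mul_coord hp r i, Finset.sum_mul]
    refine Finset.sum_congr rfl fun j _ => ?_
    rw [H.pdx_metric_symm hp j r]; ring
  have h4 : ∑ i, ∑ j, pdx j (metric L i r) x y * y i * y j =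
      (1 / 2) * ∑ j, pdx j (pdy r (energy L)) x y * y j := by
    rw [← h3, Finset.sum_comm]
    refine Finset.sum_congr rfl fun _ _ => Finset.sum_congr rfl fun _ _ => by ring
  have h5 := H.sum_sum_pdx_metric_mul_coord hp r
  rw [h2]
  calc _ = (1 / 4) * (∑ i, ∑ j, pdx i (metric L j r) x y * y i * y j +
        ∑ i, ∑ j, pdx j (metric L i r) x y * y i * y j -
        ∑ i, ∑ j, pdx r (metric L i j) x y * y i * y j) := by
        simp only [h1, ← Finset.sum_add_distrib, ← Finset.sum_sub_distrib, Finset.mul_sum]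
        refine Finset.sum_congr rfl fun _ _ => Finset.sum_congr rfl fun _ _ => by ring
    _ = _ := by rw [h3, h4, h5]; ring

theorem smooth_christoffel (H : IsLocalFinsler D L) (i j k : Fin n) :
    SmoothIn D (christoffel L i j k) :=
  (SmoothIn.const _).mul (SmoothIn.sum fun r => (H.smooth_metricInv i r).mul
    ((((H.smooth_metric k r).pdx H.isOpen j).add ((H.smooth_metric j r).pdx H.isOpen k)).sub
      ((H.smooth_metric j k).pdx H.isOpen r)))

theorem smooth_spray (H : IsLocalFinsler D L) (h : Fin n) : SmoothIn D (spray L h) :=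
  (SmoothIn.const _).mul (SmoothIn.sum fun i => SmoothIn.sum fun j =>
    ((H.smooth_christoffel h i j).mul (SmoothIn.coord i)).mul (SmoothIn.coord j))

theorem smooth_barthel (H : IsLocalFinsler D L) (i j : Fin n) : SmoothIn D (barthel L i j) :=
  (H.smooth_spray i).pdy H.isOpen j

theorem smooth_delta (H : IsLocalFinsler D L) {F : Coord n → Coord n → ℝ} (hF : SmoothIn D F)
    (k : Fin n) : SmoothIn D (delta L k F) :=
  hF.delta H.isOpen k fun r => H.smooth_barthel r k

theorem smooth_cartanGamma (H : IsLocalFinsler D L) (i j k : Fin n) :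
    SmoothIn D (cartanGamma L i j k) :=
  (SmoothIn.const _).mul (SmoothIn.sum fun r => (H.smooth_metricInv i r).mul
    (((H.smooth_delta (H.smooth_metric k r) j).add (H.smooth_delta (H.smooth_metric j r) k)).sub
      (H.smooth_delta (H.smooth_metric j k) r)))

theorem smooth_hCov (H : IsLocalFinsler D L) {A : Fin n → Coord n → Coord n → ℝ}
    (hA : ∀ i, SmoothIn D (A i)) (i j : Fin n) : SmoothIn D (hCov L A i j) :=
  (H.smooth_delta (hA i) j).sub
    (SmoothIn.sum fun r => (hA r).mul (H.smooth_cartanGamma r i j))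

theorem homog_spray (H : IsLocalFinsler D L) (h : Fin n) : HomogIn D 2 (spray L h) := by
  intro x y hp c hc
  have h1 : ∀ i j, christoffel L h i j x (c • y) = christoffel L h i j x y := by
    intro i j
    have h2 : ∀ k i j, pdx k (metric L i j) x (c • y) = pdx k (metric L i j) x y := fun k i j => by
      simpa using (H.homog_metric i j).pdx (H.smooth_metric i j) H.isOpen k x y hp c hc
    have h3 : ∀ i j, metricInv L i j x (c • y) = metricInv L i j x y := fun i j => by
      simpa using H.homog_metricInv i j x y hp c hc
    simp only [christoffel, h2, h3]
  simp only [spray, h1, PiLp.smul_apply, smul_eq_mul, Finset.mul_sum]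
  refine Finset.sum_congr rfl fun _ _ => Finset.sum_congr rfl fun _ _ => by ring

theorem sum_barthel_mul_coord (H : IsLocalFinsler D L) (hp : (x, y) ∈ D) (i : Fin n) :
    ∑ j, barthel L i j x y * y j = 2 * spray L i x y := by
  simpa [barthel] using (H.homog_spray i).euler (H.smooth_spray i) H.isOpen hp

/-- The lowered Barthel connection. -/
theorem lower_barthel (H : IsLocalFinsler D L) (hp : (x, y) ∈ D) (r k : Fin n) :
    ∑ s, metric L r s x y * barthel L s k x y =
      (1 / 4) * (pdx k (pdy r (energy L)) x y - pdx r (pdy k (energy L)) x y) +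
      (1 / 2) * ∑ j, pdx j (metric L k r) x y * y j -
      ∑ s, spray L s x y * pdy s (metric L k r) x y := by
  have hD := H.isOpen
  have hsm : ∀ j, SmoothIn D (pdx j (pdy r (energy L))) :=
    fun j => (H.smooth_pdy_energy r).pdx hD j
  -- Differentiate the lowered spray identity in $y^k$. On the left, the derivative falling on
  -- $g_{rs}$ gives the term $G^s\dot\partial_sg_{kr}$ by symmetry of the Cartan tensor.
  have e1 := dirDeriv_sum hD hp
    (fun s => (H.smooth_metric r s).mul (H.smooth_spray s)) (0, basisVec k)
  rw [dirDeriv_congr hD hp (fun _ _ hp => H.lower_spray hp r),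
    dirDeriv_const_mul hD hp _ ((SmoothIn.sum fun j => (hsm j).mul (SmoothIn.coord j)).sub
      (H.smooth_energy.pdx hD r)),
    dirDeriv_sub hD hp (SmoothIn.sum fun j => (hsm j).mul (SmoothIn.coord j))
      (H.smooth_energy.pdx hD r), dirDeriv_sum_mul_coord hD hp hsm] at e1
  have e2 : ∀ s, dirDeriv (0, basisVec k) (fun x y => metric L r s x y * spray L s x y) x y =
      metric L r s x y * barthel L s k x y + spray L s x y * pdy s (metric L k r) x y := by
    intro s
    rw [dirDeriv_mul hD hp (H.smooth_metric r s) (H.smooth_spray s),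
      ← pdy_eq_dirDeriv hD hp (H.smooth_spray s), ← pdy_eq_dirDeriv hD hp (H.smooth_metric r s),
      H.pdy_metric_symm hp r s, H.pdy_metric_comm hp k]
    rfl
  have e3 : ∀ j, dirDeriv (0, basisVec k) (pdx j (pdy r (energy L))) x y =
      2 * pdx j (metric L k r) x y := by
    intro j
    rw [← pdy_eq_dirDeriv hD hp (hsm j), ← pdx_pdy_comm hD hp (H.smooth_pdy_energy r),
      pdx_eq_dirDeriv hD hp (H.smooth_metric k r), H.dirDeriv_metric hp,
      ← pdx_eq_dirDeriv hD hp ((H.smooth_pdy_energy r).pdy hD k)]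
    ring
  have e4 : ∑ j, pdx j (pdy r (energy L)) x y * (basisVec k : Coord n) j =
      pdx k (pdy r (energy L)) x y := by
    simp [basisVec]
  have e5 : dirDeriv (0, basisVec k) (pdx r (energy L)) x y = pdx r (pdy k (energy L)) x y := by
    rw [← pdy_eq_dirDeriv hD hp (H.smooth_energy.pdx hD r), pdx_pdy_comm hD hp H.smooth_energy]
  simp only [e2, e3, e5] at e1
  rw [e4, Finset.sum_add_distrib] at e1
  have e6 : ∑ j, 2 * pdx j (metric L k r) x y * y j = 2 * ∑ j, pdx j (metric L k r) x y * y j := by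
    rw [Finset.mul_sum]; exact Finset.sum_congr rfl fun _ _ => by ring
  linarith

theorem lower_cartanGamma (H : IsLocalFinsler D L) (hp : (x, y) ∈ D) (r j k : Fin n) :
    ∑ s, metric L r s x y * cartanGamma L s j k x y = (1 / 2) *
      (delta L j (metric L k r) x y + delta L k (metric L j r) x y -
        delta L r (metric L j k) x y) :=
  H.lower_raise hp (fun r => delta L j (metric L k r) x y + delta L k (metric L j r) x y -
        delta L r (metric L j k) x y) r

theorem cartanGamma_symm (H : IsLocalFinsler D L) (hp : (x, y) ∈ D) (i j k : Fin n) :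
    cartanGamma L i j k x y = cartanGamma L i k j x y := by
  simp only [cartanGamma, H.delta_metric_symm L hp k j]
  congr 1
  exact Finset.sum_congr rfl fun _ _ => by ring

/-- The vertical part of $\delta_k$ drops out, because $y$ annihilates the Cartan tensor. -/
theorem sum_delta_metric_mul_coord (H : IsLocalFinsler D L) (hp : (x, y) ∈ D) (i k : Fin n) :
    ∑ j, delta L k (metric L i j) x y * y j = (1 / 2) * pdx k (pdy i (energy L)) x y := by
  have h : ∀ s, ∑ j, pdy s (metric L i j) x y * y j = 0 := fun s => by
    simpa only [H.pdy_metric_symm hp i] using H.sum_pdy_metric_mul_coord hp s i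
  calc _ = ∑ j, pdx k (metric L i j) x y * y j -
        ∑ s, barthel L s k x y * ∑ j, pdy s (metric L i j) x y * y j := by
        simp only [delta, sub_mul, Finset.sum_sub_distrib, Finset.sum_mul, Finset.mul_sum]
        rw [Finset.sum_comm (s := Finset.univ) (t := Finset.univ)
          (f := fun s j => barthel L s k x y * (pdy s (metric L i j) x y * y j))]
        simp only [mul_assoc]
    _ = _ := by simp [h, H.sum_pdx_metric_mul_coord hp]

/-- The deflection tensor of the Cartan connection vanishes. -/
theorem sum_cartanGamma_mul_coord (H : IsLocalFinsler D L) (hp : (x, y) ∈ D) (i k : Fin n) :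
    ∑ j, cartanGamma L i j k x y * y j = barthel L i k x y := by
  refine H.eq_of_lower_eq hp (a := fun i => ∑ j, cartanGamma L i j k x y * y j)
    (b := fun i => barthel L i k x y) (fun r => ?_) i
  have h1 : ∑ s, metric L r s x y * ∑ j, cartanGamma L s j k x y * y j =
      ∑ j, (∑ s, metric L r s x y * cartanGamma L s j k x y) * y j := by
    simp only [Finset.mul_sum, Finset.sum_mul]
    rw [Finset.sum_comm]
    refine Finset.sum_congr rfl fun _ _ => Finset.sum_congr rfl fun _ _ => by ring
  -- Here $y$ meets the index of $\delta_j$ rather than of $g$, so the vertical part survives: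
  -- $N^s_jy^j=2G^s$.
  have h2 : ∑ j, delta L j (metric L k r) x y * y j = ∑ j, pdx j (metric L k r) x y * y j -
      2 * ∑ s, spray L s x y * pdy s (metric L k r) x y := by
    simp only [delta, sub_mul, Finset.sum_sub_distrib]
    congr 1
    simp only [Finset.sum_mul, Finset.mul_sum]
    rw [Finset.sum_comm]
    refine Finset.sum_congr rfl fun s _ => ?_
    rw [← mul_assoc, ← H.sum_barthel_mul_coord hp s, Finset.sum_mul]
    exact Finset.sum_congr rfl fun _ _ => by ring
  have h3 := H.sum_delta_metric_mul_coord hp r k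
  have h4 := H.sum_delta_metric_mul_coord hp k r
  have h5 := H.lower_barthel hp r k
  simp only [h1, H.lower_cartanGamma hp]
  rw [h5]
  calc _ = (1 / 2) * (∑ j, delta L j (metric L k r) x y * y j +
        ∑ j, delta L k (metric L r j) x y * y j - ∑ j, delta L r (metric L k j) x y * y j) := by
        rw [← Finset.sum_add_distrib, ← Finset.sum_sub_distrib, Finset.mul_sum]
        refine Finset.sum_congr rfl fun j _ => ?_
        rw [H.delta_metric_symm L hp r j, H.delta_metric_symm L hp k j]; ring
    _ = _ := by rw [h2, h3, h4]; ring

/-- The coefficients $\Gamma$ alone determine the spray, hence $N$ and $\delta$; the necessity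
arguments start from this. -/
theorem sum_sum_cartanGamma_mul_coord (H : IsLocalFinsler D L) (hp : (x, y) ∈ D) (i : Fin n) :
    ∑ k, (∑ j, cartanGamma L i j k x y * y j) * y k = 2 * spray L i x y := by
  simp only [H.sum_cartanGamma_mul_coord hp, H.sum_barthel_mul_coord hp]

end IsLocalFinsler

/-! ### Parallel objects -/

/-- `F` is horizontally constant for the Cartan connection of `L`. -/
def ParallelScalar (D : Set (Coord n × Coord n)) (L F : Coord n → Coord n → ℝ) : Prop :=
  ∀ x y, (x, y) ∈ D → ∀ k, delta L k F x y = 0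

/-- The covector field `A` is parallel for the Cartan connection of `L`. -/
def ParallelCovector (D : Set (Coord n × Coord n)) (L : Coord n → Coord n → ℝ)
    (A : Fin n → Coord n → Coord n → ℝ) : Prop :=
  ∀ x y, (x, y) ∈ D → ∀ i k, delta L k (A i) x y = ∑ r, A r x y * cartanGamma L r i k x y

/-- The tensor field `T_ij` is parallel for the Cartan connection of `L`. -/
def ParallelTensor (D : Set (Coord n × Coord n)) (L : Coord n → Coord n → ℝ)
    (T : Fin n → Fin n → Coord n → Coord n → ℝ) : Prop :=
  ∀ x y, (x, y) ∈ D → ∀ i j k, delta L k (T i j) x y =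
    ∑ r, T r j x y * cartanGamma L r i k x y + ∑ r, T i r x y * cartanGamma L r j k x y

theorem hCov_eq_zero_iff {A : Fin n → Coord n → Coord n → ℝ} {i k : Fin n} :
    hCov L A i k x y = 0 ↔ delta L k (A i) x y = ∑ r, A r x y * cartanGamma L r i k x y :=
  sub_eq_zero

namespace IsLocalFinsler

/-- In the sum of the two lowered Christoffel expressions all terms cancel except $\delta_kg_{ij}$,
which occurs twice with coefficient $\frac12$. -/
theorem parallel_metric (H : IsLocalFinsler D L) : ParallelTensor D L (metric L) := by
  intro x y hp i j k
  simp only [H.metric_symm hp _ j]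
  rw [H.lower_cartanGamma hp, H.lower_cartanGamma hp, H.delta_metric_symm L hp k i,
    H.delta_metric_symm L hp k j, H.delta_metric_symm L hp j i]
  ring

/-- Product rule with $\delta_ky^j=-N^j_k$. -/
theorem delta_sum_mul_coord (H : IsLocalFinsler D L) (hp : (x, y) ∈ D)
    {A : Fin n → Coord n → Coord n → ℝ} (hA : ∀ i, SmoothIn D (A i)) (k : Fin n) :
    delta L k (fun x y => ∑ j, A j x y * y j) x y =
      ∑ j, delta L k (A j) x y * y j - ∑ j, A j x y * barthel L j k x y := by
  rw [delta_eq_dirDeriv L H.isOpen hp (SmoothIn.sum fun j => (hA j).mul (SmoothIn.coord j)),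
    dirDeriv_sum_mul_coord H.isOpen hp hA]
  simp only [horizVec_snd, delta_eq_dirDeriv L H.isOpen hp (hA _), mul_neg,
    Finset.sum_neg_distrib, sub_eq_add_neg]

/-- A parallel covector contracted with the supporting element is horizontally constant. -/
theorem _root_.FinslerChange.ParallelCovector.contract {A : Fin n → Coord n → Coord n → ℝ}
    (h : ParallelCovector D L A) (H : IsLocalFinsler D L) (hA : ∀ i, SmoothIn D (A i)) :
    ParallelScalar D L fun x y => ∑ j, A j x y * y j := by
  intro x y hp k
  rw [H.delta_sum_mul_coord hp hA]
  simp only [h x y hp, ← H.sum_cartanGamma_mul_coord hp, Finset.mul_sum, Finset.sum_mul]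
  rw [Finset.sum_comm, sub_eq_zero]
  refine Finset.sum_congr rfl fun _ _ => Finset.sum_congr rfl fun _ _ => by ring

/-- Up to the factor $\frac12$ this covector is $g_{ij}y^j$. The metric is parallel, and the term
$g_{ir}\Gamma^r_{jk}y^j=g_{ir}N^r_k$ cancels the derivative of $y$. -/
theorem parallel_pdy_energy (H : IsLocalFinsler D L) :
    ParallelCovector D L fun i => pdy i (energy L) := by
  intro x y hp i k
  have h1 := H.delta_sum_mul_coord hp (H.smooth_metric i) k
  rw [delta_eq_dirDeriv L H.isOpen hp (SmoothIn.sum fun j =>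
      (H.smooth_metric i j).mul (SmoothIn.coord j)),
    dirDeriv_congr H.isOpen hp (fun _ _ hp => H.sum_metric_mul_coord hp i),
    dirDeriv_const_mul H.isOpen hp _ (H.smooth_pdy_energy i),
    ← delta_eq_dirDeriv L H.isOpen hp (H.smooth_pdy_energy i)] at h1
  have h2 : ∑ j, delta L k (metric L i j) x y * y j =
      ∑ r, (∑ j, metric L r j x y * y j) * cartanGamma L r i k x y +
      ∑ r, metric L i r x y * ∑ j, cartanGamma L r j k x y * y j := by
    simp only [H.parallel_metric x y hp, add_mul, Finset.sum_add_distrib, Finset.sum_mul,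
      Finset.mul_sum]
    congr 1 <;>
    · rw [Finset.sum_comm]
      refine Finset.sum_congr rfl fun _ _ => Finset.sum_congr rfl fun _ _ => by ring
  simp only [H.sum_metric_mul_coord hp, H.sum_cartanGamma_mul_coord hp] at h2
  have h3 : ∑ r, 1 / 2 * pdy r (energy L) x y * cartanGamma L r i k x y =
      1 / 2 * ∑ r, pdy r (energy L) x y * cartanGamma L r i k x y := by
    rw [Finset.mul_sum]; exact Finset.sum_congr rfl fun _ _ => by ring
  linarith

/-- By Euler, $2L^2$ is the parallel covector $\dot\partial_iL^2$ contracted with $y$; then divide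
$\delta_kL^2=2L\,\delta_kL$ by $L>0$. -/
theorem parallelScalar_self (H : IsLocalFinsler D L) : ParallelScalar D L L := by
  intro x y hp k
  have h := H.parallel_pdy_energy.contract H H.smooth_pdy_energy x y hp k
  rw [delta_eq_dirDeriv L H.isOpen hp (SmoothIn.sum fun j =>
      (H.smooth_pdy_energy j).mul (SmoothIn.coord j)),
    dirDeriv_congr H.isOpen hp (fun _ _ hp => H.sum_pdy_energy_mul_coord hp),
    dirDeriv_const_mul H.isOpen hp _ H.smooth_energy] at h
  unfold energy at h
  rw [dirDeriv_sq H.isOpen hp H.smooth] at h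
  rw [delta_eq_dirDeriv L H.isOpen hp H.smooth]
  have := (H.pos x y hp).ne'
  simpa [this] using h

theorem pdy_energy (H : IsLocalFinsler D L) (hp : (x, y) ∈ D) (i : Fin n) :
    pdy i (energy L) x y = 2 * (L x y * pdy i L x y) := by
  rw [pdy_eq_dirDeriv H.isOpen hp H.smooth_energy, pdy_eq_dirDeriv H.isOpen hp H.smooth]
  unfold energy
  rw [dirDeriv_sq H.isOpen hp H.smooth]; ring

/-- The supporting covector of a horizontally constant Finsler function is parallel, for the
Cartan connection of another one, if the differential of the energy is. -/
theorem parallelCovector_pdy_of_energy (H : IsLocalFinsler D L) (h0 : ParallelScalar D L' L)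
    (h1 : ParallelCovector D L' fun i => pdy i (energy L)) :
    ParallelCovector D L' fun i => pdy i L := by
  intro x y hp i k
  have h := h1 x y hp i k
  have hs := H.smooth.pdy H.isOpen i
  have h0' := h0 x y hp k
  rw [delta_eq_dirDeriv L' H.isOpen hp H.smooth] at h0'
  rw [delta_eq_dirDeriv L' H.isOpen hp (H.smooth_pdy_energy i),
    dirDeriv_congr H.isOpen hp (fun _ _ hp => H.pdy_energy hp i),
    dirDeriv_const_mul H.isOpen hp _ (H.smooth.mul hs), dirDeriv_mul H.isOpen hp H.smooth hs,
    h0'] at h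
  simp only [H.pdy_energy hp] at h
  rw [delta_eq_dirDeriv L' H.isOpen hp hs]
  have hL := (H.pos x y hp).ne'
  apply mul_left_cancel₀ (mul_ne_zero two_ne_zero hL)
  rw [Finset.mul_sum]
  simp only [mul_zero, add_zero] at h
  rw [mul_assoc, h]
  exact Finset.sum_congr rfl fun _ _ => by ring

theorem parallel_pdy (H : IsLocalFinsler D L) : ParallelCovector D L fun i => pdy i L :=
  H.parallelCovector_pdy_of_energy H.parallelScalar_self H.parallel_pdy_energy

theorem metric_eq_mul_add (H : IsLocalFinsler D L) (hp : (x, y) ∈ D) (i j : Fin n) :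
    metric L i j x y = L x y * pdy i (pdy j L) x y + pdy j L x y * pdy i L x y := by
  have hs := H.smooth.pdy H.isOpen j
  rw [metric_eq]
  beta_reduce
  rw [pdy_congr H.isOpen hp (fun _ _ hp => H.pdy_energy hp j),
    pdy_eq_dirDeriv H.isOpen hp ((SmoothIn.const 2).mul (H.smooth.mul hs)),
    dirDeriv_const_mul H.isOpen hp _ (H.smooth.mul hs), dirDeriv_mul H.isOpen hp H.smooth hs,
    pdy_eq_dirDeriv H.isOpen hp hs, pdy_eq_dirDeriv H.isOpen hp H.smooth i,
    pdy_eq_dirDeriv H.isOpen hp H.smooth j]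
  ring

/-- In $g_{ij}=L\,\dot\partial_i\dot\partial_jL+\dot\partial_iL\,\dot\partial_jL$ everything else is
parallel and $L>0$, so the Hessian of $L$ is parallel too. -/
theorem parallel_pdy_pdy (H : IsLocalFinsler D L) :
    ParallelTensor D L fun i j => pdy i (pdy j L) := by
  intro x y hp i j k
  have hD := H.isOpen
  have hs := fun j => H.smooth.pdy hD j
  have hss := (hs j).pdy hD i
  have h := H.parallel_metric x y hp i j k
  have h0 := H.parallelScalar_self x y hp k
  have h1 := fun i => H.parallel_pdy x y hp i k
  simp only [delta_eq_dirDeriv L hD hp (hs _)] at h1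
  rw [delta_eq_dirDeriv L hD hp H.smooth] at h0
  rw [delta_eq_dirDeriv L hD hp (H.smooth_metric i j),
    dirDeriv_congr hD hp (fun _ _ hp => H.metric_eq_mul_add hp i j),
    dirDeriv_add hD hp (H.smooth.mul hss) ((hs j).mul (hs i)),
    dirDeriv_mul hD hp H.smooth hss, dirDeriv_mul hD hp (hs j) (hs i), h0, h1, h1] at h
  simp only [H.metric_eq_mul_add hp, add_mul, Finset.sum_add_distrib] at h
  rw [delta_eq_dirDeriv L hD hp hss]
  apply mul_left_cancel₀ (H.pos x y hp).ne'
  simp only [Finset.mul_sum, mul_add] at h ⊢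
  have e1 : ∀ a b : Fin n, ∑ r, pdy a L x y * (pdy r L x y * cartanGamma L r b k x y) =
      ∑ r, pdy r L x y * pdy a L x y * cartanGamma L r b k x y :=
    fun a b => Finset.sum_congr rfl fun _ _ => by ring
  have e2 : ∀ a b : Fin n, ∑ r, pdy a L x y * pdy r L x y * cartanGamma L r b k x y =
      ∑ r, pdy r L x y * pdy a L x y * cartanGamma L r b k x y :=
    fun a b => Finset.sum_congr rfl fun _ _ => by ring
  simp only [e1, e2] at h
  simp only [mul_assoc] at h ⊢
  linarith

/-! ### Comparison of two Cartan connections -/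

theorem barthel_eq_of_spray_eq (H : IsLocalFinsler D L)
    (h : ∀ x y, (x, y) ∈ D → ∀ i, spray L' i x y = spray L i x y) (hp : (x, y) ∈ D)
    (i j : Fin n) : barthel L' i j x y = barthel L i j x y :=
  pdy_congr H.isOpen hp (fun x y hp => h x y hp i) j

theorem delta_eq_of_spray_eq (H : IsLocalFinsler D L)
    (h : ∀ x y, (x, y) ∈ D → ∀ i, spray L' i x y = spray L i x y) (hp : (x, y) ∈ D)
    (k : Fin n) (F : Coord n → Coord n → ℝ) : delta L' k F x y = delta L k F x y := by
  simp only [delta, H.barthel_eq_of_spray_eq h hp]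

/-- A Finsler function which is horizontally constant for `L` has the same spray. -/
theorem spray_eq_of_parallelScalar (H : IsLocalFinsler D L) (H' : IsLocalFinsler D L')
    (h : ParallelScalar D L L') (hp : (x, y) ∈ D) (i : Fin n) :
    spray L' i x y = spray L i x y := by
  have hD := H.isOpen
  have hx : ∀ x y, (x, y) ∈ D → ∀ k, pdx k (energy L') x y =
      ∑ r, barthel L r k x y * pdy r (energy L') x y := by
    intro x y hp k
    rw [← sub_eq_zero]
    change delta L k (energy L') x y = 0
    rw [delta_eq_dirDeriv L hD hp H'.smooth_energy]
    unfold energy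
    rw [dirDeriv_sq hD hp H'.smooth, ← delta_eq_dirDeriv L hD hp H'.smooth, h x y hp k, mul_zero]
  -- Contracting with $y$ turns $N$ into $2G$, the spray of $L$.
  have hs : ∀ x y, (x, y) ∈ D → ∑ j, pdx j (energy L') x y * y j =
      2 * ∑ s, spray L s x y * pdy s (energy L') x y := by
    intro x y hp
    simp only [hx x y hp, Finset.sum_mul, Finset.mul_sum]
    rw [Finset.sum_comm]
    refine Finset.sum_congr rfl fun s _ => ?_
    rw [← mul_assoc, ← H.sum_barthel_mul_coord hp, Finset.sum_mul]
    exact Finset.sum_congr rfl fun _ _ => by ring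
  refine H'.eq_of_lower_eq hp (a := fun i => spray L' i x y) (b := fun i => spray L i x y)
    (fun r => ?_) i
  have hsm := fun j => H'.smooth_energy.pdx hD j
  -- The $y^r$-derivative of `hs` contains $\partial_r\overline L^2$ once on the left and, through
  -- `hx`, twice on the right. What remains is the lowered spray equation of $\overline L$, solved
  -- by the spray of $L$.
  have e1 := dirDeriv_sum_mul_coord hD hp hsm (0, basisVec r)
  have hsm2 := fun s => (H.smooth_spray s).mul (H'.smooth_pdy_energy s)
  rw [dirDeriv_congr hD hp hs, dirDeriv_const_mul hD hp _ (SmoothIn.sum hsm2),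
    dirDeriv_sum hD hp hsm2] at e1
  have e2 : ∑ j, pdx j (energy L') x y * (basisVec r : Coord n) j = pdx r (energy L') x y := by
    simp [basisVec]
  have e3 : ∀ s, dirDeriv (0, basisVec r)
      (fun x y => spray L s x y * pdy s (energy L') x y) x y =
      2 * (metric L' r s x y * spray L s x y) +
        barthel L s r x y * pdy s (energy L') x y := by
    intro s
    rw [dirDeriv_mul hD hp (H.smooth_spray s) (H'.smooth_pdy_energy s),
      ← pdy_eq_dirDeriv hD hp (H.smooth_spray s),
      ← pdy_eq_dirDeriv hD hp (H'.smooth_pdy_energy s), metric_eq]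
    simp only [barthel]; ring
  have e4 : ∀ j, dirDeriv (0, basisVec r) (pdx j (energy L')) x y =
      pdx j (pdy r (energy L')) x y := by
    intro j
    rw [← pdy_eq_dirDeriv hD hp (hsm j), pdx_pdy_comm hD hp H'.smooth_energy]
  simp only [e3, e4] at e1
  rw [e2, Finset.sum_add_distrib, ← hx x y hp, ← Finset.mul_sum] at e1
  rw [H'.lower_spray hp]
  linarith

/-- The Cartan connection of `L` is that of any Finsler function which it preserves together
with its metric tensor. -/
theorem difference_eq_zero (H : IsLocalFinsler D L) (H' : IsLocalFinsler D L')
    (h : ParallelScalar D L L') (hg : ParallelTensor D L (metric L')) (hp : (x, y) ∈ D)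
    (i j k : Fin n) : difference L L' i j k x y = 0 := by
  have hd := fun k F => H.delta_eq_of_spray_eq
    (fun x y hp i => H.spray_eq_of_parallelScalar H' h hp i) hp k F
  refine sub_eq_zero.2 (H'.eq_of_lower_eq hp (a := fun i => cartanGamma L' i j k x y)
    (b := fun i => cartanGamma L i j k x y) (fun r => ?_) i)
  -- Christoffel's argument: with $\delta$ common and $\overline g$ parallel for $L$, symmetry of
  -- $\Gamma$ leaves $\overline g_{rs}\Gamma^s_{jk}$ twice, against the factor $\frac12$.
  rw [H'.lower_cartanGamma hp]
  simp only [hd, hg x y hp, H.cartanGamma_symm hp _ k j, H.cartanGamma_symm hp _ r,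
    H'.metric_symm hp _ r, H'.metric_symm hp _ k]
  ring

/-- If two Cartan connections have the same horizontal coefficients, each Finsler function and
its supporting covector are parallel for the other connection. -/
theorem parallel_of_difference_eq_zero (H : IsLocalFinsler D L) (H' : IsLocalFinsler D L')
    (h : ∀ x y, (x, y) ∈ D → ∀ i j k, difference L L' i j k x y = 0) :
    ParallelScalar D L L' ∧ ParallelCovector D L fun i => pdy i L' := by
  have hΓ : ∀ x y, (x, y) ∈ D → ∀ i j k, cartanGamma L' i j k x y = cartanGamma L i j k x y :=
    fun x y hp i j k => sub_eq_zero.1 (h x y hp i j k)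
  have hd : ∀ x y, (x, y) ∈ D → ∀ k F, delta L' k F x y = delta L k F x y := by
    refine fun x y hp k F => H.delta_eq_of_spray_eq (fun x y hp i => ?_) hp k F
    have h1 := H'.sum_sum_cartanGamma_mul_coord hp i
    have h2 := H.sum_sum_cartanGamma_mul_coord hp i
    simp only [hΓ x y hp] at h1
    linarith
  refine ⟨fun x y hp k => ?_, fun x y hp i k => ?_⟩
  · rw [← hd x y hp]; exact H'.parallelScalar_self x y hp k
  · rw [← hd x y hp, H'.parallel_pdy x y hp]
    simp only [hΓ x y hp]

end IsLocalFinsler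

end FinslerChange
end

noncomputable section

namespace FinslerChange

variable {n : ℕ}

/-! ### Functions of two scalars -/

/-- Partial derivative in the first argument. -/
def partialFst (h : ℝ × ℝ → ℝ) (p : ℝ × ℝ) : ℝ := fderiv ℝ h p (1, 0)

/-- Partial derivative in the second argument. -/
def partialSnd (h : ℝ × ℝ → ℝ) (p : ℝ × ℝ) : ℝ := fderiv ℝ h p (0, 1)

variable {Ω : Set (ℝ × ℝ)} {f h : ℝ × ℝ → ℝ}

theorem contDiffOn_partialFst (hΩ : IsOpen Ω) (hh : ContDiffOn ℝ ∞ h Ω) :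
    ContDiffOn ℝ ∞ (partialFst h) Ω :=
  (hh.fderiv_of_isOpen hΩ (m := ∞) (by simp)).clm_apply contDiffOn_const

theorem contDiffOn_partialSnd (hΩ : IsOpen Ω) (hh : ContDiffOn ℝ ∞ h Ω) :
    ContDiffOn ℝ ∞ (partialSnd h) Ω :=
  (hh.fderiv_of_isOpen hΩ (m := ∞) (by simp)).clm_apply contDiffOn_const

/-- A first derivative of a function of degree one has degree zero, so its vanishing at a point
spreads along the ray. -/
theorem IsChangeFunction.partialSnd_smul (hf : IsChangeFunction Ω f) {p : ℝ × ℝ} (hp : p ∈ Ω)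
    {c : ℝ} (hc : 0 < c) : partialSnd f (c • p) = partialSnd f p := by
  have hd : ∀ {q}, q ∈ Ω → DifferentiableAt ℝ f q := fun hq =>
    (hf.smooth.contDiffAt (hf.isOpen.mem_nhds hq)).differentiableAt (by simp)
  have h1 : HasFDerivAt (fun q => f (c • q))
      ((fderiv ℝ f (c • p)).comp (c • ContinuousLinearMap.id ℝ (ℝ × ℝ))) p :=
    (hd (hf.smul_mem p hp c hc)).hasFDerivAt.comp p ((hasFDerivAt_id p).const_smul c)
  have h2 : HasFDerivAt (fun q => c * f q) (c • fderiv ℝ f p) p := (hd hp).hasFDerivAt.const_mul _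
  have he : (fun q => f (c • q)) =ᶠ[nhds p] fun q => c * f q := by
    filter_upwards [hf.isOpen.mem_nhds hp] with q hq using hf.homogeneous q hq c hc
  have := congrArg (fun T => T ((0, 1) : ℝ × ℝ)) (h1.unique (h2.congr_of_eventuallyEq he))
  simp only [ContinuousLinearMap.comp_apply, smul_apply, ContinuousLinearMap.id_apply, map_smul,
    smul_eq_mul] at this
  exact mul_left_cancel₀ hc.ne' this

/-- If `∂f/∂β` vanishes identically on no open set, it does not vanish on an interval of
values of the ratio of the arguments. -/
theorem IsChangeFunction.ratio_eq (hf : IsChangeFunction Ω f) (hd : DependsOnBeta Ω f)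
    {X : Type*} [TopologicalSpace X] {W : Set X} (hW : IsPreconnected W) {A B : X → ℝ}
    (hA : ContinuousOn A W) (hB : ContinuousOn B W) (hpos : ∀ w ∈ W, 0 < A w)
    (hΩ : ∀ w ∈ W, (A w, B w) ∈ Ω) (h0 : ∀ w ∈ W, partialSnd f (A w, B w) = 0)
    {p q : X} (hp : p ∈ W) (hq : q ∈ W) : B q / A q = B p / A p := by
  have hcont : ContinuousOn (fun w => B w / A w) W := hB.div hA fun w hw => (hpos w hw).ne'
  have himg := (hW.image _ hcont).ordConnected
  have key : ∀ p ∈ W, ∀ q ∈ W, ¬ B p / A p < B q / A q := by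
    intro p hp q hq hlt
    have hmem : ∀ t, B p / A p < t → t < B q / A q → ∃ w ∈ W, B w / A w = t := fun t h1 h2 =>
      himg.out (Set.mem_image_of_mem _ hp) (Set.mem_image_of_mem _ hq) ⟨h1.le, h2.le⟩
    set a := B p / A p
    set b := B q / A q
    -- The open sector of slopes between the two ratios. By connectedness every slope in it is
    -- attained on `W`, so $\partial f/\partial\beta$ would vanish on its intersection with `Ω`.
    -- That set is nonempty: it contains a value with slope $(a+b)/2$.
    have hcone : IsOpen {r : ℝ × ℝ | 0 < r.1 ∧ a * r.1 < r.2 ∧ r.2 < b * r.1} := by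
      simp only [Set.ofPred_and]
      refine (isOpen_lt ?_ ?_).inter ((isOpen_lt ?_ ?_).inter (isOpen_lt ?_ ?_)) <;> fun_prop
    obtain ⟨r, ⟨hr, hr0, hr1, hr2⟩, hne⟩ := hd _ (hf.isOpen.inter hcone) Set.inter_subset_left (by
      obtain ⟨w, hw, hwt⟩ := hmem ((a + b) / 2) (by linarith) (by linarith)
      refine ⟨(A w, B w), hΩ w hw, hpos w hw, ?_⟩
      have : B w = (a + b) / 2 * A w := by rw [← hwt]; field_simp [(hpos w hw).ne']
      have hw0 := hpos w hw
      simp only [this]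
      constructor <;> nlinarith)
    obtain ⟨w, hw, hwt⟩ := hmem (r.2 / r.1) ((lt_div_iff₀ hr0).2 hr1) ((div_lt_iff₀ hr0).2 hr2)
    have hw0 := hpos w hw
    -- Equal slopes and positive first coordinates put both points on one ray.
    have : r = (r.1 / A w) • (A w, B w) := by
      ext
      · simp [hw0.ne']
      · have : B w = r.2 / r.1 * A w := by rw [← hwt]; field_simp
        simp only [Prod.smul_mk, smul_eq_mul, this]
        field_simp
    apply hne
    change partialSnd f r = 0
    rw [this, hf.partialSnd_smul (hΩ w hw) (by positivity), h0 w hw]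
  rcases lt_trichotomy (B p / A p) (B q / A q) with h | h | h
  · exact absurd h (key p hp q hq)
  · exact h.symm
  · exact absurd h (key q hq p hp)

variable {D : Set (Coord n × Coord n)} {L L' A B F : Coord n → Coord n → ℝ} {x y : Coord n}

theorem SmoothIn.comp₂ (hh : ContDiffOn ℝ ∞ h Ω) (hA : SmoothIn D A) (hB : SmoothIn D B)
    (hAB : ∀ x y, (x, y) ∈ D → (A x y, B x y) ∈ Ω) : SmoothIn D fun x y => h (A x y, B x y) :=
  ContDiffOn.comp (g := h) hh (ContDiffOn.prodMk hA hB) fun p hp => hAB p.1 p.2 hp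

theorem dirDeriv_comp₂ (hΩ : IsOpen Ω) (hh : ContDiffOn ℝ ∞ h Ω) (hD : IsOpen D)
    (hp : (x, y) ∈ D) (hA : SmoothIn D A) (hB : SmoothIn D B)
    (hAB : ∀ x y, (x, y) ∈ D → (A x y, B x y) ∈ Ω) (v : Coord n × Coord n) :
    dirDeriv v (fun x y => h (A x y, B x y)) x y =
      partialFst h (A x y, B x y) * dirDeriv v A x y +
      partialSnd h (A x y, B x y) * dirDeriv v B x y := by
  have hd : DifferentiableAt ℝ h (A x y, B x y) :=
    (hh.contDiffAt (hΩ.mem_nhds (hAB x y hp))).differentiableAt (by simp)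
  have := (HasFDerivAt.comp (f := fun p : Coord n × Coord n => (A p.1 p.2, B p.1 p.2)) (x, y)
    hd.hasFDerivAt ((hA.differentiableAt hD hp).hasFDerivAt.prodMk
      (hB.differentiableAt hD hp).hasFDerivAt)).fderiv
  simp only [Function.comp_def] at this
  rw [dirDeriv, this]
  simp only [ContinuousLinearMap.comp_apply, ContinuousLinearMap.prod_apply]
  change fderiv ℝ h (A x y, B x y) (dirDeriv v A x y, dirDeriv v B x y) = _
  have e : ((dirDeriv v A x y, dirDeriv v B x y) : ℝ × ℝ) =
      dirDeriv v A x y • (1, 0) + dirDeriv v B x y • (0, 1) := by simp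
  rw [e, map_add, map_smul, map_smul, partialFst, partialSnd, smul_eq_mul, smul_eq_mul]
  ring

/-! ### Operations on parallel objects -/

theorem ParallelScalar.comp₂ (hΩ : IsOpen Ω) (hh : ContDiffOn ℝ ∞ h Ω) (hD : IsOpen D)
    (hA : SmoothIn D A) (hB : SmoothIn D B) (hAB : ∀ x y, (x, y) ∈ D → (A x y, B x y) ∈ Ω)
    (pA : ParallelScalar D L A) (pB : ParallelScalar D L B) :
    ParallelScalar D L fun x y => h (A x y, B x y) := by
  intro x y hp k
  have h1 := pA x y hp k
  have h2 := pB x y hp k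
  rw [delta_eq_dirDeriv L hD hp hA] at h1
  rw [delta_eq_dirDeriv L hD hp hB] at h2
  rw [delta_eq_dirDeriv L hD hp (SmoothIn.comp₂ hh hA hB hAB),
    dirDeriv_comp₂ hΩ hh hD hp hA hB hAB, h1, h2]
  ring

theorem delta_congr (hD : IsOpen D) (hp : (x, y) ∈ D) (hA : SmoothIn D A)
    (h : ∀ x y, (x, y) ∈ D → B x y = A x y) (k : Fin n) :
    delta L k B x y = delta L k A x y := by
  rw [delta_eq_dirDeriv L hD hp hA, delta_eq_dirDeriv L hD hp (hA.congr h),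
    dirDeriv_congr hD hp h]

theorem ParallelTensor.congr {T S : Fin n → Fin n → Coord n → Coord n → ℝ} (hD : IsOpen D)
    (hT : ∀ i j, SmoothIn D (T i j)) (p : ParallelTensor D L T)
    (h : ∀ i j x y, (x, y) ∈ D → S i j x y = T i j x y) : ParallelTensor D L S := by
  intro x y hp i j k
  rw [delta_congr hD hp (hT i j) (h i j), p x y hp]
  simp only [h _ _ x y hp]

theorem ParallelTensor.add {T S : Fin n → Fin n → Coord n → Coord n → ℝ} (hD : IsOpen D)
    (hT : ∀ i j, SmoothIn D (T i j)) (hS : ∀ i j, SmoothIn D (S i j))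
    (pT : ParallelTensor D L T) (pS : ParallelTensor D L S) :
    ParallelTensor D L fun i j x y => T i j x y + S i j x y := by
  intro x y hp i j k
  have h1 := pT x y hp i j k
  have h2 := pS x y hp i j k
  rw [delta_eq_dirDeriv L hD hp (hT i j)] at h1
  rw [delta_eq_dirDeriv L hD hp (hS i j)] at h2
  rw [delta_eq_dirDeriv L hD hp ((hT i j).add (hS i j)), dirDeriv_add hD hp (hT i j) (hS i j),
    h1, h2]
  simp only [add_mul, Finset.sum_add_distrib]
  ring

theorem ParallelTensor.smul {T : Fin n → Fin n → Coord n → Coord n → ℝ} (hD : IsOpen D)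
    (hF : SmoothIn D F) (hT : ∀ i j, SmoothIn D (T i j))
    (pF : ParallelScalar D L F) (pT : ParallelTensor D L T) :
    ParallelTensor D L fun i j x y => F x y * T i j x y := by
  intro x y hp i j k
  have h1 := pF x y hp k
  have h2 := pT x y hp i j k
  rw [delta_eq_dirDeriv L hD hp hF] at h1
  rw [delta_eq_dirDeriv L hD hp (hT i j)] at h2
  rw [delta_eq_dirDeriv L hD hp (hF.mul (hT i j)), dirDeriv_mul hD hp hF (hT i j), h1, h2]
  simp only [mul_assoc, ← Finset.mul_sum]
  ring

theorem ParallelCovector.smul {P : Fin n → Coord n → Coord n → ℝ} (hD : IsOpen D)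
    (hF : SmoothIn D F) (hP : ∀ i, SmoothIn D (P i))
    (pF : ParallelScalar D L F) (pP : ParallelCovector D L P) :
    ParallelCovector D L fun i x y => F x y * P i x y := by
  intro x y hp i k
  have h1 := pF x y hp k
  have h2 := pP x y hp i k
  rw [delta_eq_dirDeriv L hD hp hF] at h1
  rw [delta_eq_dirDeriv L hD hp (hP i)] at h2
  rw [delta_eq_dirDeriv L hD hp (hF.mul (hP i)), dirDeriv_mul hD hp hF (hP i), h1, h2]
  simp only [mul_assoc, ← Finset.mul_sum]
  ring

theorem ParallelCovector.congr {P Q : Fin n → Coord n → Coord n → ℝ} (hD : IsOpen D)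
    (hP : ∀ i, SmoothIn D (P i)) (p : ParallelCovector D L P)
    (h : ∀ i x y, (x, y) ∈ D → Q i x y = P i x y) : ParallelCovector D L Q := by
  intro x y hp i k
  rw [delta_congr hD hp (hP i) (h i), p x y hp]
  simp only [h _ x y hp]

theorem ParallelCovector.mul {P Q : Fin n → Coord n → Coord n → ℝ} (hD : IsOpen D)
    (hP : ∀ i, SmoothIn D (P i)) (hQ : ∀ i, SmoothIn D (Q i))
    (pP : ParallelCovector D L P) (pQ : ParallelCovector D L Q) :
    ParallelTensor D L fun i j x y => P i x y * Q j x y := by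
  intro x y hp i j k
  have h1 := pP x y hp i k
  have h2 := pQ x y hp j k
  rw [delta_eq_dirDeriv L hD hp (hP i)] at h1
  rw [delta_eq_dirDeriv L hD hp (hQ j)] at h2
  rw [delta_eq_dirDeriv L hD hp ((hP i).mul (hQ j)), dirDeriv_mul hD hp (hP i) (hQ j), h1, h2,
    Finset.mul_sum, Finset.mul_sum, add_comm]
  congr 1 <;> exact Finset.sum_congr rfl fun _ _ => by ring

/-- A scalar that is parallel together with its first two derivatives in `y`. -/
structure ParallelJet (D : Set (Coord n × Coord n)) (L A : Coord n → Coord n → ℝ) : Prop where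
  smooth : SmoothIn D A
  scalar : ParallelScalar D L A
  covector : ParallelCovector D L fun i => pdy i A
  tensor : ParallelTensor D L fun i j => pdy i (pdy j A)

theorem pdy_comp₂ (hΩ : IsOpen Ω) (hh : ContDiffOn ℝ ∞ h Ω) (hD : IsOpen D)
    (hp : (x, y) ∈ D) (hA : SmoothIn D A) (hB : SmoothIn D B)
    (hAB : ∀ x y, (x, y) ∈ D → (A x y, B x y) ∈ Ω) (i : Fin n) :
    pdy i (fun x y => h (A x y, B x y)) x y =
      partialFst h (A x y, B x y) * pdy i A x y + partialSnd h (A x y, B x y) * pdy i B x y := by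
  rw [pdy_eq_dirDeriv hD hp (SmoothIn.comp₂ hh hA hB hAB), pdy_eq_dirDeriv hD hp hA,
    pdy_eq_dirDeriv hD hp hB, dirDeriv_comp₂ hΩ hh hD hp hA hB hAB]

theorem pdy_mul (hD : IsOpen D) (hp : (x, y) ∈ D) (hA : SmoothIn D A) (hB : SmoothIn D B)
    (i : Fin n) : pdy i (fun x y => A x y * B x y) x y =
      A x y * pdy i B x y + B x y * pdy i A x y := by
  rw [pdy_eq_dirDeriv hD hp (hA.mul hB), pdy_eq_dirDeriv hD hp hA, pdy_eq_dirDeriv hD hp hB,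
    dirDeriv_mul hD hp hA hB]

theorem pdy_add (hD : IsOpen D) (hp : (x, y) ∈ D) (hA : SmoothIn D A) (hB : SmoothIn D B)
    (i : Fin n) : pdy i (fun x y => A x y + B x y) x y = pdy i A x y + pdy i B x y := by
  rw [pdy_eq_dirDeriv hD hp (hA.add hB), pdy_eq_dirDeriv hD hp hA, pdy_eq_dirDeriv hD hp hB,
    dirDeriv_add hD hp hA hB]

/-- The `y`-Hessian of a function of two parallel scalars is parallel. -/
theorem ParallelJet.hessian_comp₂ (hΩ : IsOpen Ω) (hh : ContDiffOn ℝ ∞ h Ω) (hD : IsOpen D)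
    (jA : ParallelJet D L A) (jB : ParallelJet D L B)
    (hAB : ∀ x y, (x, y) ∈ D → (A x y, B x y) ∈ Ω) :
    ParallelTensor D L fun i j => pdy i (pdy j fun x y => h (A x y, B x y)) := by
  have hA := jA.smooth
  have hB := jB.smooth
  have hA1 := fun i => hA.pdy hD i
  have hB1 := fun i => hB.pdy hD i
  have hA2 := fun i j => (hA1 j).pdy hD i
  have hB2 := fun i j => (hB1 j).pdy hD i
  have h1 := contDiffOn_partialFst hΩ hh
  have h2 := contDiffOn_partialSnd hΩ hh
  have sm : ∀ {g}, ContDiffOn ℝ ∞ g Ω → SmoothIn D fun x y => g (A x y, B x y) :=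
    fun hg => SmoothIn.comp₂ hg hA hB hAB
  have pS : ∀ {g}, ContDiffOn ℝ ∞ g Ω → ParallelScalar D L fun x y => g (A x y, B x y) :=
    fun hg => ParallelScalar.comp₂ hΩ hg hD hA hB hAB jA.scalar jB.scalar
  -- The first derivative is a sum of two terms $g(A,B)\,\dot\partial_jC$, with $g$ a partial
  -- derivative of $h$ and $C$ equal to $A$ or $B$. The $y^i$-derivative of such a term is handled
  -- once for both.
  have half : ∀ {g} {C : Coord n → Coord n → ℝ}, ContDiffOn ℝ ∞ g Ω → ParallelJet D L C →
      ((∀ i j, SmoothIn D fun x y => partialFst g (A x y, B x y) * (pdy i A x y * pdy j C x y) +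
        partialSnd g (A x y, B x y) * (pdy i B x y * pdy j C x y) +
        g (A x y, B x y) * pdy i (pdy j C) x y) ∧
      ParallelTensor D L fun i j x y =>
        partialFst g (A x y, B x y) * (pdy i A x y * pdy j C x y) +
        partialSnd g (A x y, B x y) * (pdy i B x y * pdy j C x y) +
        g (A x y, B x y) * pdy i (pdy j C) x y) := by
    intro g C hg jC
    have hC1 := fun i => jC.smooth.pdy hD i
    have s1 := fun i j => (hA1 i).mul (hC1 j)
    have s2 := fun i j => (hB1 i).mul (hC1 j)
    have s3 := fun i j => (hC1 j).pdy hD i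
    have g1 := contDiffOn_partialFst hΩ hg
    have g2 := contDiffOn_partialSnd hΩ hg
    have t1 := ParallelTensor.smul hD (sm g1) s1 (pS g1)
      (ParallelCovector.mul hD hA1 hC1 jA.covector jC.covector)
    have t2 := ParallelTensor.smul hD (sm g2) s2 (pS g2)
      (ParallelCovector.mul hD hB1 hC1 jB.covector jC.covector)
    have t3 := ParallelTensor.smul hD (sm hg) s3 (pS hg) jC.tensor
    have u1 := fun i j => (sm g1).mul (s1 i j)
    have u2 := fun i j => (sm g2).mul (s2 i j)
    have u3 := fun i j => (sm hg).mul (s3 i j)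
    exact ⟨fun i j => ((u1 i j).add (u2 i j)).add (u3 i j),
      ParallelTensor.add hD (fun i j => (u1 i j).add (u2 i j)) u3
        (ParallelTensor.add hD u1 u2 t1 t2) t3⟩
  obtain ⟨sA, tA⟩ := half h1 jA
  obtain ⟨sB, tB⟩ := half h2 jB
  refine ParallelTensor.congr hD (fun i j => (sA i j).add (sB i j))
    (ParallelTensor.add hD sA sB tA tB) fun i j x y hp => ?_
  rw [pdy_congr hD hp fun _ _ hp => pdy_comp₂ hΩ hh hD hp hA hB hAB j,
    pdy_add hD hp ((sm h1).mul (hA1 j)) ((sm h2).mul (hB1 j)), pdy_mul hD hp (sm h1) (hA1 j),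
    pdy_mul hD hp (sm h2) (hB1 j), pdy_comp₂ hΩ h1 hD hp hA hB hAB,
    pdy_comp₂ hΩ h2 hD hp hA hB hAB]
  ring

/-! ### Generalized changes in coordinates -/

/-- A change by a function of two parallel scalars preserves the Cartan connection. -/
theorem difference_eq_zero_of_parallelJet (H : IsLocalFinsler D L) (H' : IsLocalFinsler D L')
    (hf : IsChangeFunction Ω f) (jA : ParallelJet D L A) (jB : ParallelJet D L B)
    (hAB : ∀ x y, (x, y) ∈ D → (A x y, B x y) ∈ Ω)
    (hL' : ∀ x y, (x, y) ∈ D → L' x y = f (A x y, B x y)) (hp : (x, y) ∈ D) (i j k : Fin n) :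
    difference L L' i j k x y = 0 := by
  have hD := H.isOpen
  have hs := SmoothIn.comp₂ hf.smooth jA.smooth jB.smooth hAB
  refine H.difference_eq_zero H' (fun x y hp k => ?_) ?_ hp i j k
  · rw [delta_congr hD hp hs hL']
    exact ParallelScalar.comp₂ hf.isOpen hf.smooth hD jA.smooth jB.smooth hAB jA.scalar
      jB.scalar x y hp k
  -- The Hessian lemma is applied to $f^2$, since $\overline g$ is half the Hessian of $\overline
  -- L^2$.
  · have hsq : ContDiffOn ℝ ∞ (fun p => f p ^ 2) Ω := hf.smooth.pow 2
    have ht := ParallelJet.hessian_comp₂ hf.isOpen hsq hD jA jB hAB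
    have hs2 := fun i j =>
      (((SmoothIn.comp₂ hsq jA.smooth jB.smooth hAB).pdy hD j).pdy hD i :)
    refine ParallelTensor.congr hD (fun i j => (SmoothIn.const (1 / 2)).mul (hs2 i j))
      (ParallelTensor.smul hD (SmoothIn.const (1 / 2)) hs2 (fun x y hp k => ?_) ht)
      fun i j x y hp => ?_
    · rw [delta_eq_dirDeriv L hD hp (SmoothIn.const _), dirDeriv_const]
    · rw [metric_eq]
      beta_reduce
      congr 1
      refine pdy_congr hD hp (fun x y hp => pdy_congr hD hp (fun x y hp => ?_) j) i
      rw [energy, hL' x y hp]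

/-- A locally constant multiple of `L` is parallel with its derivatives in `y`. -/
theorem IsLocalFinsler.parallelJet_mul (H : IsLocalFinsler D L) {ρ : Coord n → Coord n → ℝ}
    (hρ : SmoothIn D ρ) (h0 : ∀ x y, (x, y) ∈ D → ∀ v, dirDeriv v ρ x y = 0) :
    ParallelJet D L fun x y => ρ x y * L x y := by
  have hD := H.isOpen
  have hy : ∀ {F : Coord n → Coord n → ℝ}, SmoothIn D F → ∀ i x y, (x, y) ∈ D →
      pdy i (fun x y => ρ x y * F x y) x y = ρ x y * pdy i F x y := by
    intro F hF i x y hp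
    rw [pdy_mul hD hp hρ hF, pdy_eq_dirDeriv hD hp hρ, h0 x y hp]; ring
  have hpρ : ParallelScalar D L ρ := fun x y hp k => by
    rw [delta_eq_dirDeriv L hD hp hρ, h0 x y hp]
  have s1 := fun i => H.smooth.pdy hD i
  have s2 := fun i j => (s1 j).pdy hD i
  refine ⟨hρ.mul H.smooth, fun x y hp k => ?_, ?_, ?_⟩
  · have := H.parallelScalar_self x y hp k
    rw [delta_eq_dirDeriv L hD hp H.smooth] at this
    rw [delta_eq_dirDeriv L hD hp (hρ.mul H.smooth), dirDeriv_mul hD hp hρ H.smooth, this,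
      h0 x y hp]
    ring
  · exact ParallelCovector.congr hD (fun i => hρ.mul (s1 i))
      (ParallelCovector.smul hD hρ s1 hpρ H.parallel_pdy) fun i => hy H.smooth i
  · refine ParallelTensor.congr hD (fun i j => hρ.mul (s2 i j))
      (ParallelTensor.smul hD hρ s2 hpρ H.parallel_pdy_pdy) fun i j x y hp => ?_
    rw [pdy_congr hD hp (hy H.smooth j), hy (s1 j) i x y hp]

variable {b : Fin n → Coord n → Coord n → ℝ}

theorem pdy_eq_zero (hFy : ∀ x y z, F x y = F x z) (i : Fin n) (x y : Coord n) :
    pdy i F x y = 0 := by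
  have : (fun z => F x z) = fun _ => F x y := funext fun z => hFy x z y
  rw [pdy, this]
  simp

theorem pdy_form (hD : IsOpen D) (hp : (x, y) ∈ D) (hb : ∀ i, SmoothIn D (b i))
    (hby : ∀ i x y z, b i x y = b i x z) (i : Fin n) :
    pdy i (fun x y => ∑ j, b j x y * y j) x y = b i x y := by
  have h0 : ∀ j, pdy i (b j) x y = 0 := fun j => pdy_eq_zero (hby j) i x y
  simp only [pdy_eq_dirDeriv hD hp (hb _)] at h0
  have hs := SmoothIn.sum fun j => (hb j).mul (SmoothIn.coord j)
  rw [pdy_eq_dirDeriv hD hp hs, dirDeriv_sum_mul_coord hD hp hb]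
  simp only [h0]
  simp [basisVec]

/-- As $\beta$ is linear in $y$, its $y$-gradient is $b$ and its $y$-Hessian is zero, so parallelism
of $b$ is all that is needed. -/
theorem IsLocalFinsler.parallelJet_form (H : IsLocalFinsler D L) (hb : ∀ i, SmoothIn D (b i))
    (hby : ∀ i x y z, b i x y = b i x z) (h : ParallelCovector D L b) :
    ParallelJet D L fun x y => ∑ j, b j x y * y j := by
  have hD := H.isOpen
  refine ⟨SmoothIn.sum fun j => (hb j).mul (SmoothIn.coord j), h.contract H hb, ?_, ?_⟩
  · exact ParallelCovector.congr hD hb h fun i x y hp => pdy_form hD hp hb hby i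
  · refine ParallelTensor.congr (T := fun _ _ _ _ => 0) hD (fun _ _ => SmoothIn.const 0)
      (fun x y hp i j k => ?_) fun i j x y hp => ?_
    · rw [delta_eq_dirDeriv L hD hp (SmoothIn.const 0), dirDeriv_const]; simp
    · rw [pdy_congr hD hp fun x y hp => pdy_form hD hp hb hby j, pdy_eq_zero (hby j)]

/-! ### Necessity in coordinates. -/

/-- A conformal change that preserves the Cartan connection has a horizontally constant
factor. -/
theorem IsLocalFinsler.delta_factor_eq_zero (H : IsLocalFinsler D L) (H' : IsLocalFinsler D L')
    {ρ : Coord n → Coord n → ℝ} (hρ : SmoothIn D ρ)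
    (hL' : ∀ x y, (x, y) ∈ D → L' x y = ρ x y * L x y)
    (h : ∀ x y, (x, y) ∈ D → ∀ i j k, difference L L' i j k x y = 0) (hp : (x, y) ∈ D)
    (k : Fin n) : delta L k ρ x y = 0 := by
  have hD := H.isOpen
  have h1 := (H.parallel_of_difference_eq_zero H' h).1 x y hp k
  have h2 := H.parallelScalar_self x y hp k
  rw [delta_eq_dirDeriv L hD hp H.smooth] at h2
  rw [delta_congr hD hp (hρ.mul H.smooth) hL', delta_eq_dirDeriv L hD hp (hρ.mul H.smooth),
    dirDeriv_mul hD hp hρ H.smooth, h2, ← delta_eq_dirDeriv L hD hp hρ] at h1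
  simpa [(H.pos x y hp).ne'] using h1

/-- If a `β`-change preserves the Cartan connection, the one-form is parallel where
`∂f/∂β ≠ 0`. -/
theorem IsLocalFinsler.hCov_eq_zero_of_partialSnd_ne_zero (H : IsLocalFinsler D L)
    (H' : IsLocalFinsler D L') (hf : IsChangeFunction Ω f) (hb : ∀ i, SmoothIn D (b i))
    (hby : ∀ i x y z, b i x y = b i x z)
    (hAB : ∀ x y, (x, y) ∈ D → (L x y, ∑ j, b j x y * y j) ∈ Ω)
    (hL' : ∀ x y, (x, y) ∈ D → L' x y = f (L x y, ∑ j, b j x y * y j))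
    (h : ∀ x y, (x, y) ∈ D → ∀ i j k, difference L L' i j k x y = 0) (hp : (x, y) ∈ D)
    (hne : partialSnd f (L x y, ∑ j, b j x y * y j) ≠ 0) (i k : Fin n) :
    hCov L b i k x y = 0 := by
  have hD := H.isOpen
  obtain ⟨p0, p1⟩ := H.parallel_of_difference_eq_zero H' h
  have hB : SmoothIn D fun x y => ∑ j, b j x y * y j :=
    SmoothIn.sum fun j => (hb j).mul (SmoothIn.coord j)
  have hs := SmoothIn.comp₂ hf.smooth H.smooth hB hAB
  have s1 := contDiffOn_partialFst hf.isOpen hf.smooth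
  have s2 := contDiffOn_partialSnd hf.isOpen hf.smooth
  have hLi := H.smooth.pdy hD i
  have e0 := p0 x y hp k
  have eL := H.parallelScalar_self x y hp k
  rw [delta_eq_dirDeriv L hD hp H.smooth] at eL
  rw [delta_congr hD hp hs hL', delta_eq_dirDeriv L hD hp hs,
    dirDeriv_comp₂ hf.isOpen hf.smooth hD hp H.smooth hB hAB, eL, mul_zero, zero_add] at e0
  -- Now $\delta_kL=\delta_k\beta=0$ at the point, so the coefficients $f_\alpha(L,\beta)$ and
  -- $f_\beta(L,\beta)$ of $\dot\partial_i\overline L$ also have zero $\delta_k$ there. With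
  -- $\dot\partial_iL$ parallel, only $f_\beta b_{i|k}$ is left.
  have eB := (mul_eq_zero.1 e0).resolve_left hne
  have hy : ∀ i x y, (x, y) ∈ D → pdy i L' x y =
      partialFst f (L x y, ∑ j, b j x y * y j) * pdy i L x y +
      partialSnd f (L x y, ∑ j, b j x y * y j) * b i x y := by
    intro i x y hp
    rw [pdy_congr hD hp hL', pdy_comp₂ hf.isOpen hf.smooth hD hp H.smooth hB hAB,
      pdy_form hD hp hb hby]
  have t1 := SmoothIn.comp₂ s1 H.smooth hB hAB
  have t2 := SmoothIn.comp₂ s2 H.smooth hB hAB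
  have e1 := p1 x y hp i k
  have eLi := H.parallel_pdy x y hp i k
  rw [delta_eq_dirDeriv L hD hp hLi] at eLi
  rw [delta_eq_dirDeriv L hD hp (H'.smooth.pdy hD i), dirDeriv_congr hD hp (hy i),
    dirDeriv_add hD hp (t1.mul hLi) (t2.mul (hb i)), dirDeriv_mul hD hp t1 hLi,
    dirDeriv_mul hD hp t2 (hb i), dirDeriv_comp₂ hf.isOpen s1 hD hp H.smooth hB hAB,
    dirDeriv_comp₂ hf.isOpen s2 hD hp H.smooth hB hAB, eL, eB, eLi] at e1
  simp only [hy _ x y hp, add_mul, Finset.sum_add_distrib, mul_assoc, ← Finset.mul_sum] at e1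
  rw [hCov_eq_zero_iff, delta_eq_dirDeriv L hD hp (hb i)]
  apply mul_left_cancel₀ hne
  linarith

/-- If a `β`-change by a function that really depends on `β` preserves the Cartan connection,
the one-form is parallel. -/
theorem IsLocalFinsler.hCov_eq_zero_of_difference_eq_zero (H : IsLocalFinsler D L)
    (H' : IsLocalFinsler D L') (hf : IsChangeFunction Ω f) (hd : DependsOnBeta Ω f)
    (hb : ∀ i, SmoothIn D (b i)) (hby : ∀ i x y z, b i x y = b i x z)
    (hAB : ∀ x y, (x, y) ∈ D → (L x y, ∑ j, b j x y * y j) ∈ Ω)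
    (hL' : ∀ x y, (x, y) ∈ D → L' x y = f (L x y, ∑ j, b j x y * y j))
    (h : ∀ x y, (x, y) ∈ D → ∀ i j k, difference L L' i j k x y = 0) (hp : (x, y) ∈ D)
    (i k : Fin n) : hCov L b i k x y = 0 := by
  have hD := H.isOpen
  by_contra hne
  have hB : SmoothIn D fun x y => ∑ j, b j x y * y j :=
    SmoothIn.sum fun j => (hb j).mul (SmoothIn.coord j)
  have hc : ContinuousAt (fun p : Coord n × Coord n => hCov L b i k p.1 p.2) (x, y) :=
    ((H.smooth_hCov hb i k).contDiffAt (hD.mem_nhds hp)).continuousAt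
  obtain ⟨ε, hε, hball⟩ := Metric.mem_nhds_iff.1
    (Filter.inter_mem (hD.mem_nhds hp) (hc.eventually_ne hne))
  -- A ball in $D$ on which $b_{i|k}\ne0$. It is convex, hence preconnected as `ratio_eq` requires.
  set W := Metric.ball ((x, y) : Coord n × Coord n) ε
  have hWD : W ⊆ D := fun p hp => (hball hp).1
  have hpW : (x, y) ∈ W := Metric.mem_ball_self hε
  have h0 : ∀ w ∈ W, partialSnd f (L w.1 w.2, ∑ j, b j w.1 w.2 * w.2 j) = 0 := by
    intro w hw
    by_contra h0
    exact (hball hw).2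
      (H.hCov_eq_zero_of_partialSnd_ne_zero H' hf hb hby hAB hL' h (hWD hw) h0 i k)
  set c := (∑ j, b j x y * y j) / L x y
  have hBL : ∀ x y, (x, y) ∈ W → ∑ j, b j x y * y j = c * L x y := by
    intro x' y' hw
    have := hf.ratio_eq hd (convex_ball _ _).isPreconnected
      (A := fun w : Coord n × Coord n => L w.1 w.2)
      (B := fun w : Coord n × Coord n => ∑ j, b j w.1 w.2 * w.2 j)
      (ContDiffOn.continuousOn H.smooth |>.mono hWD) (ContDiffOn.continuousOn hB |>.mono hWD)
      (fun w hw => H.pos _ _ (hWD hw)) (fun w hw => hAB _ _ (hWD hw)) h0 hpW hw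
    exact (div_eq_iff (H.pos _ _ (hWD hw)).ne').1 this
  have hWo : IsOpen W := Metric.isOpen_ball
  have hLW := H.smooth.mono hWD
  -- Differentiate $\beta=cL$ in $y^i$; the right side is parallel, against the choice of `W`.
  have hbi : ∀ i x y, (x, y) ∈ W → b i x y = c * pdy i L x y := by
    intro i x y hw
    rw [← pdy_form hWo hw (fun i => (hb i).mono hWD) hby i, pdy_congr hWo hw hBL,
      pdy_eq_dirDeriv hWo hw ((SmoothIn.const c).mul hLW), dirDeriv_const_mul hWo hw c hLW,
      pdy_eq_dirDeriv hWo hw hLW]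
  have hs := fun i => hLW.pdy hWo i
  have hcon : ParallelScalar W L fun _ _ => c := fun x y hw k => by
    rw [delta_eq_dirDeriv L hWo hw (SmoothIn.const c), dirDeriv_const]
  exact hne (hCov_eq_zero_iff.2 (ParallelCovector.congr hWo
    (fun i => (SmoothIn.const c).mul (hs i))
    (ParallelCovector.smul hWo (SmoothIn.const c) hs hcon
      fun x y hw => H.parallel_pdy x y (hWD hw)) hbi x y hpW i k))

end FinslerChange
end

noncomputable section

namespace FinslerChange

variable {n : ℕ} {M : Type*} [TopologicalSpace M] [ChartedSpace (Coord n) M]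

/-! ### Coordinate expressions of objects on the tangent bundle -/

theorem contMDiff_tangentBundle_mk :
    ContMDiff 𝓘(ℝ, Coord n × Coord n) (𝓡 n).tangent ∞
      (fun p : Coord n × Coord n => (⟨p.1, p.2⟩ : TangentBundle (𝓡 n) (Coord n))) := by
  intro p
  refine Bundle.contMDiffAt_totalSpace.2 ⟨contDiffAt_fst.contMDiffAt, ?_⟩
  have h : ContDiffAt ℝ ∞ (fun p : Coord n × Coord n => p.2) p := contDiffAt_snd
  exact h.contMDiffAt.congr_of_eventuallyEq (.of_forall fun q => by simp)

theorem lift_smul (e : OpenPartialHomeomorph M (Coord n)) (x y : Coord n) (c : ℝ) :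
    lift e x (c • y) = ⟨(lift e x y).1, c • (lift e x y).2⟩ := by
  simp only [lift, tangentMap]
  congr 1
  exact map_smul (mfderiv (𝓡 n) (𝓡 n) e.symm x) c y

theorem inChart_betaFun (e : OpenPartialHomeomorph M (Coord n))
    (b : ∀ x : M, TangentSpace (𝓡 n) x →L[ℝ] ℝ) (x y : Coord n) :
    inChart e (betaFun b) x y = ∑ j, formComp e b j x y * y j := by
  let T : Coord n →L[ℝ] ℝ := (b (e.symm x)).comp (mfderiv (𝓡 n) (𝓡 n) e.symm x)
  change T y = ∑ j, T (basisVec j) * y j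
  conv_lhs => rw [← sum_smul_basisVec y]
  simp [mul_comm]

theorem inChart_genChange (e : OpenPartialHomeomorph M (Coord n)) (f : ℝ × ℝ → ℝ) (σ : M → ℝ)
    (b : ∀ x : M, TangentSpace (𝓡 n) x →L[ℝ] ℝ) (L : TangentBundle (𝓡 n) M → ℝ)
    (x y : Coord n) : inChart e (genChange f σ b L) x y =
      f (Real.exp (σ (e.symm x)) * inChart e L x y, ∑ j, formComp e b j x y * y j) := by
  rw [← inChart_betaFun]
  rfl

variable {e : OpenPartialHomeomorph M (Coord n)}
  {U : Set (TangentBundle (𝓡 n) M)} {L F : TangentBundle (𝓡 n) M → ℝ}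
  {σ : M → ℝ} {b : ∀ x : M, TangentSpace (𝓡 n) x →L[ℝ] ℝ}

theorem contDiffOn_comp_symm (he : e ∈ IsManifold.maximalAtlas (𝓡 n) ∞ M)
    (hσ : ContMDiff (𝓡 n) 𝓘(ℝ, ℝ) ∞ σ) : ContDiffOn ℝ ∞ (fun x => σ (e.symm x)) e.target :=
  (hσ.comp_contMDiffOn (contMDiffOn_symm_of_mem_maximalAtlas he)).contDiffOn

theorem mdifferentiable_of_mem_maximalAtlas (he : e ∈ IsManifold.maximalAtlas (𝓡 n) ∞ M) :
    e.MDifferentiable (𝓡 n) (𝓡 n) :=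
  ⟨(contMDiffOn_of_mem_maximalAtlas he).mdifferentiableOn (by simp),
    (contMDiffOn_symm_of_mem_maximalAtlas he).mdifferentiableOn (by simp)⟩

/-- Places a conformal change under the common sufficiency criterion. -/
theorem cartanParallel_of_eq_zero (hb : ∀ x, b x = 0) : CartanParallel U L b := by
  intro e _ p _ i j
  have : ∀ i, formComp e b i = fun _ _ => 0 := fun i => by
    ext x y
    simp [formComp, betaFun, hb]
  simp [hCov, this, delta, pdx, pdy]

theorem homothetic_of_eq_zero (hσ : ∀ x, σ x = 0) : Homothetic n σ := by
  intro x
  have : σ = fun _ => 0 := funext hσ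
  rw [this]
  exact mfderiv_const

theorem smoothIn_exp (he : e ∈ IsManifold.maximalAtlas (𝓡 n) ∞ M)
    (hσ : ContMDiff (𝓡 n) 𝓘(ℝ, ℝ) ∞ σ) :
    SmoothIn (chartDomain e U) fun x _ => Real.exp (σ (e.symm x)) :=
  ContDiffOn.exp (ContDiffOn.comp (g := fun x => σ (e.symm x)) (contDiffOn_comp_symm he hσ)
    contDiff_fst.contDiffOn fun _ hp => hp.1)

theorem hasFDerivAt_comp_symm (he : e ∈ IsManifold.maximalAtlas (𝓡 n) ∞ M)
    (hσ : ContMDiff (𝓡 n) 𝓘(ℝ, ℝ) ∞ σ) (h : Homothetic n σ) {x : Coord n} (hx : x ∈ e.target) :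
    HasFDerivAt (fun x => σ (e.symm x)) (0 : Coord n →L[ℝ] ℝ) x := by
  have h1 := (hσ.mdifferentiable (by simp) (e.symm x)).hasMFDerivAt
  have h2 := ((mdifferentiable_of_mem_maximalAtlas he).mdifferentiableAt_symm hx).hasMFDerivAt
  have h3 := (h1.comp x h2).hasFDerivAt
  rw [h] at h3
  convert! h3 using 1

theorem dirDeriv_exp_eq_zero (he : e ∈ IsManifold.maximalAtlas (𝓡 n) ∞ M)
    (hσ : ContMDiff (𝓡 n) 𝓘(ℝ, ℝ) ∞ σ) (h : Homothetic n σ) {x y : Coord n}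
    (hx : x ∈ e.target) (v : Coord n × Coord n) :
    dirDeriv v (fun x _ => Real.exp (σ (e.symm x))) x y = 0 := by
  have h1 : HasFDerivAt (fun p : Coord n × Coord n => σ (e.symm p.1))
      ((0 : Coord n →L[ℝ] ℝ).comp (ContinuousLinearMap.fst ℝ (Coord n) (Coord n))) (x, y) :=
    HasFDerivAt.comp (f := fun p : Coord n × Coord n => p.1) (x, y)
      (hasFDerivAt_comp_symm he hσ h hx) hasFDerivAt_fst
  simp [dirDeriv, h1.exp.fderiv]

/-- Near $x$ one has $\sigma=(\sigma\circ e^{-1})\circ e$; apply the chain rule. -/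
theorem mfderiv_eq_zero_of_fderiv (he : e ∈ IsManifold.maximalAtlas (𝓡 n) ∞ M)
    (hσ : ContMDiff (𝓡 n) 𝓘(ℝ, ℝ) ∞ σ) {x : M} (hx : x ∈ e.source)
    (h : fderiv ℝ (fun x => σ (e.symm x)) (e x) = 0) : mfderiv (𝓡 n) 𝓘(ℝ, ℝ) σ x = 0 := by
  have hd : HasFDerivAt (fun x => σ (e.symm x)) (0 : Coord n →L[ℝ] ℝ) (e x) := by
    rw [← h]
    exact (((contDiffOn_comp_symm he hσ).contDiffAt
      (e.open_target.mem_nhds (e.map_source hx))).differentiableAt (by simp)).hasFDerivAt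
  have h2 := ((mdifferentiable_of_mem_maximalAtlas he).mdifferentiableAt hx).hasMFDerivAt
  have h3 := (HasMFDerivAt.comp (I' := 𝓡 n) x hd.hasMFDerivAt h2).mfderiv
  have h4 : σ =ᶠ[nhds x] (fun x => σ (e.symm x)) ∘ e := by
    filter_upwards [e.open_source.mem_nhds hx] with z hz
    simp [e.left_inv hz]
  rw [h4.mfderiv_eq, h3]
  exact ContinuousLinearMap.zero_comp _

/-- The coordinates are given by the differential of $e$. This turns nonemptiness of the fibre of
$U$ over $x$ into a point of `chartDomain` over $e(x)$. -/
theorem exists_lift_eq (he : e ∈ IsManifold.maximalAtlas (𝓡 n) ∞ M) {x : M} (hx : x ∈ e.source)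
    (y : TangentSpace (𝓡 n) x) : ∃ z : Coord n, lift e (e x) z = ⟨x, y⟩ := by
  refine ⟨mfderiv (𝓡 n) (𝓡 n) e x y, ?_⟩
  have h := congrArg (fun T => T y)
    ((mdifferentiable_of_mem_maximalAtlas he).symm_comp_deriv hx)
  have hbase : e.symm (e x) = x := e.left_inv hx
  refine Bundle.TotalSpace.ext hbase ?_
  exact heq_of_eq h

variable [IsManifold (𝓡 n) ∞ M]

theorem contMDiffOn_lift (he : e ∈ IsManifold.maximalAtlas (𝓡 n) ∞ M) :
    ContMDiffOn 𝓘(ℝ, Coord n × Coord n) (𝓡 n).tangent ∞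
      (fun p : Coord n × Coord n => lift e p.1 p.2) {p | p.1 ∈ e.target} := by
  have h := (contMDiffOn_symm_of_mem_maximalAtlas he).contMDiffOn_tangentMapWithin
    (m := ∞) (by simp) e.open_target.uniqueMDiffOn
  refine (h.comp contMDiff_tangentBundle_mk.contMDiffOn fun p hp => hp).congr fun p hp => ?_
  have : mfderivWithin (𝓡 n) (𝓡 n) e.symm e.target p.1 = mfderiv (𝓡 n) (𝓡 n) e.symm p.1 :=
    mfderivWithin_of_isOpen e.open_target hp
  simp only [lift, tangentMap, tangentMapWithin, Function.comp_apply, this]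

theorem isOpen_chartDomain (he : e ∈ IsManifold.maximalAtlas (𝓡 n) ∞ M) (hU : IsOpen U) :
    IsOpen (chartDomain e U) :=
  (contMDiffOn_lift he).continuousOn.isOpen_inter_preimage
    (e.open_target.preimage continuous_fst) hU

theorem smoothIn_inChart (he : e ∈ IsManifold.maximalAtlas (𝓡 n) ∞ M)
    (hF : ContMDiffOn (𝓡 n).tangent 𝓘(ℝ, ℝ) ∞ F U) :
    SmoothIn (chartDomain e U) (inChart e F) :=
  (hF.comp ((contMDiffOn_lift he).mono fun _ hp => hp.1) fun _ hp => hp.2).contDiffOn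

theorem IsFinsler.isLocalFinsler (hL : IsFinsler U L) (hU : IsConicDomain U)
    (he : e ∈ IsManifold.maximalAtlas (𝓡 n) ∞ M) :
    IsLocalFinsler (chartDomain e U) (inChart e L) where
  isOpen := isOpen_chartDomain he hU.isOpen
  conic := fun x y hp c hc => ⟨hp.1, by
    change lift e x (c • y) ∈ U
    rw [lift_smul]; exact hU.smul_mem _ hp.2 c hc⟩
  smooth := smoothIn_inChart he hL.smooth
  pos := fun x y hp => hL.pos _ hp.2
  homog := fun x y hp c hc => by
    simp only [inChart, lift_smul, pow_one]
    exact hL.homogeneous _ hp.2 c hc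
  det_ne_zero := fun x y hp => hL.nondegenerate e he (x, y) hp

/-- The component $b_i$ is $\beta$ at the $i$-th coordinate vector, which need not lie in $U$; hence
the detour through the chart domain of the whole tangent bundle. -/
theorem smoothIn_formComp (he : e ∈ IsManifold.maximalAtlas (𝓡 n) ∞ M)
    (hb : ContMDiff (𝓡 n).tangent 𝓘(ℝ, ℝ) ∞ (betaFun b)) (i : Fin n) :
    SmoothIn (chartDomain e U) (formComp e b i) := by
  have h : SmoothIn (chartDomain e Set.univ) (inChart e (betaFun b)) :=
    smoothIn_inChart he hb.contMDiffOn
  exact ContDiffOn.comp (g := fun p : Coord n × Coord n => inChart e (betaFun b) p.1 p.2)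
    (f := fun p : Coord n × Coord n => (p.1, basisVec i)) h
    (contDiff_fst.prodMk contDiff_const).contDiffOn fun p hp => ⟨hp.1, trivial⟩

/-! ### Generalized changes on a manifold -/

variable {Ω : Set (ℝ × ℝ)} {f : ℝ × ℝ → ℝ}

/-- The sufficiency half of (a) and of (b) at once, with no restriction to $\beta=0$ or $\sigma=0$.
-/
theorem differenceVanishes_of_parallel (hU : IsConicDomain U) (hL : IsFinsler U L)
    (hσ : ContMDiff (𝓡 n) 𝓘(ℝ, ℝ) ∞ σ)
    (hb : ContMDiff (𝓡 n).tangent 𝓘(ℝ, ℝ) ∞ (betaFun b)) (hf : IsChangeFunction Ω f)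
    (hΩ : ∀ v ∈ U, (Real.exp (σ v.1) * L v, betaFun b v) ∈ Ω)
    (hL' : IsFinsler U (genChange f σ b L)) (h : Homothetic n σ) (hp : CartanParallel U L b) :
    DifferenceVanishes U L (genChange f σ b L) := by
  intro e he p hpD i j k
  have H := hL.isLocalFinsler hU he
  refine difference_eq_zero_of_parallelJet H (hL'.isLocalFinsler hU he) hf
    (H.parallelJet_mul (smoothIn_exp he hσ) fun x y hp v => dirDeriv_exp_eq_zero he hσ h hp.1 v)
    (H.parallelJet_form (b := formComp e b) (smoothIn_formComp he hb) (fun _ _ _ _ => rfl)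
      fun x y hq i k => hCov_eq_zero_iff.1 (hp e he (x, y) hq i k))
    (fun x y hq => ?_) (fun x y _ => inChart_genChange e f σ b L x y) hpD i j k
  rw [← inChart_betaFun]
  exact hΩ _ hq.2

theorem homothetic_of_differenceVanishes (hU : IsConicDomain U) (hL : IsFinsler U L)
    (hσ : ContMDiff (𝓡 n) 𝓘(ℝ, ℝ) ∞ σ) (hf : IsChangeFunction Ω f)
    (hΩ : ∀ v ∈ U, (Real.exp (σ v.1) * L v, betaFun b v) ∈ Ω)
    (hL' : IsFinsler U (genChange f σ b L)) (hb : ∀ x, b x = 0)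
    (h : DifferenceVanishes U L (genChange f σ b L)) : Homothetic n σ := by
  intro x
  have hβ : ∀ v, betaFun b v = 0 := fun v => by simp [betaFun, hb]
  -- With $\beta=0$ only the ray through $(1,0)$ matters, and there homogeneity makes $f$ linear.
  have hval : ∀ v ∈ U, genChange f σ b L v = f (1, 0) * Real.exp (σ v.1) * L v := by
    intro v hv
    have hpos : 0 < Real.exp (σ v.1) * L v := mul_pos (Real.exp_pos _) (hL.pos v hv)
    have hm := hΩ v hv
    rw [hβ] at hm
    have h1 : ((1, 0) : ℝ × ℝ) ∈ Ω := by
      have := hf.smul_mem _ hm _ (inv_pos.2 hpos)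
      rwa [Prod.smul_mk, smul_eq_mul, inv_mul_cancel₀ hpos.ne', smul_zero] at this
    have h2 := hf.homogeneous _ h1 _ hpos
    rw [Prod.smul_mk, smul_eq_mul, mul_one, smul_zero] at h2
    rw [genChange, hβ, h2]; ring
  obtain ⟨y, hy⟩ := hU.nonempty x
  have hc : f (1, 0) ≠ 0 := by
    intro h0
    have := hL'.pos _ hy
    rw [hval _ hy, h0] at this
    simp at this
  have he := IsManifold.chart_mem_maximalAtlas (I := 𝓡 n) (n := ∞) x
  have hx := mem_chart_source (Coord n) x
  set e := chartAt (Coord n) x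
  obtain ⟨z, hz⟩ := exists_lift_eq he hx y
  have hp : (e x, z) ∈ chartDomain e U := ⟨e.map_source hx, by rw [hz]; exact hy⟩
  have H := hL.isLocalFinsler hU he
  have hρ : SmoothIn (chartDomain e U) fun x _ => f (1, 0) * Real.exp (σ (e.symm x)) :=
    (SmoothIn.const _).mul (smoothIn_exp he hσ)
  have h0 := H.delta_factor_eq_zero (hL'.isLocalFinsler hU he) hρ
    (fun x y hq => hval _ hq.2) (fun x y hq => h e he (x, y) hq) hp
  have hd : DifferentiableAt ℝ (fun x => σ (e.symm x)) (e x) :=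
    ((contDiffOn_comp_symm he hσ).contDiffAt (e.open_target.mem_nhds hp.1)).differentiableAt
      (by simp)
  refine mfderiv_eq_zero_of_fderiv he hσ hx ?_
  -- The conformal factor does not depend on $y$, so $\delta_k$ acts on it as $\partial_k$; then
  -- cancel $f(1,0)e^\sigma\ne0$.
  have hk : ∀ k, fderiv ℝ (fun x => σ (e.symm x)) (e x) (basisVec k) = 0 := by
    intro k
    have := h0 k
    simp only [delta, pdy_eq_zero (F := fun x _ => f (1, 0) * Real.exp (σ (e.symm x)))
      (fun _ _ _ => rfl), mul_zero, Finset.sum_const_zero, sub_zero] at this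
    rw [pdx, (hd.hasFDerivAt.exp.const_mul _).fderiv] at this
    simpa [hc, Real.exp_ne_zero] using this
  ext v
  rw [← sum_smul_basisVec v]
  simp [hk]

theorem cartanParallel_of_differenceVanishes (hU : IsConicDomain U) (hL : IsFinsler U L)
    (hb : ContMDiff (𝓡 n).tangent 𝓘(ℝ, ℝ) ∞ (betaFun b)) (hf : IsChangeFunction Ω f)
    (hΩ : ∀ v ∈ U, (Real.exp (σ v.1) * L v, betaFun b v) ∈ Ω)
    (hL' : IsFinsler U (genChange f σ b L)) (hσ : ∀ x, σ x = 0) (hd : DependsOnBeta Ω f)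
    (h : DifferenceVanishes U L (genChange f σ b L)) : CartanParallel U L b := by
  intro e he p hp i k
  refine (hL.isLocalFinsler hU he).hCov_eq_zero_of_difference_eq_zero
    (hL'.isLocalFinsler hU he) hf hd (smoothIn_formComp he hb) (fun _ _ _ _ => rfl)
    (fun x y hq => ?_) (fun x y hq => ?_) (fun x y hq => h e he (x, y) hq) hp i k
  · have := hΩ _ hq.2
    rw [hσ, Real.exp_zero, one_mul] at this
    rw [← inChart_betaFun]
    exact this
  · rw [inChart_genChange, hσ, Real.exp_zero, one_mul]

end FinslerChange
end

theorem mainTheorem6 (n : ℕ) {M : Type*} [TopologicalSpace M]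
    [ChartedSpace (FinslerChange.Coord n) M] [IsManifold (𝓡 n) ∞ M]
    (U : Set (TangentBundle (𝓡 n) M)) (hU : FinslerChange.IsConicDomain U)
    (L : TangentBundle (𝓡 n) M → ℝ) (hL : FinslerChange.IsFinsler U L)
    (σ : M → ℝ) (hσ : ContMDiff (𝓡 n) 𝓘(ℝ, ℝ) ∞ σ)
    (b : ∀ x : M, TangentSpace (𝓡 n) x →L[ℝ] ℝ)
    (hb : ContMDiff (𝓡 n).tangent 𝓘(ℝ, ℝ) ∞ (FinslerChange.betaFun b))
    (Ω : Set (ℝ × ℝ)) (f : ℝ × ℝ → ℝ) (hf : FinslerChange.IsChangeFunction Ω f)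
    (hΩ : ∀ v ∈ U, (Real.exp (σ v.1) * L v, FinslerChange.betaFun b v) ∈ Ω)
    (hL' : FinslerChange.IsFinsler U (FinslerChange.genChange f σ b L)) :
    ((∀ x, b x = 0) →
      (FinslerChange.DifferenceVanishes U L (FinslerChange.genChange f σ b L) ↔
        FinslerChange.Homothetic n σ)) ∧
    ((∀ x, σ x = 0) →
      (FinslerChange.CartanParallel U L b →
        FinslerChange.DifferenceVanishes U L (FinslerChange.genChange f σ b L)) ∧
      (FinslerChange.DependsOnBeta Ω f →
        (FinslerChange.DifferenceVanishes U L (FinslerChange.genChange f σ b L) ↔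
          FinslerChange.CartanParallel U L b))) := by
  have key := FinslerChange.differenceVanishes_of_parallel hU hL hσ hb hf hΩ hL'
  refine ⟨fun h0 => ⟨FinslerChange.homothetic_of_differenceVanishes hU hL hσ hf hΩ hL' h0,
    fun h => key h (FinslerChange.cartanParallel_of_eq_zero h0)⟩, fun h0 => ?_⟩
  have hσ0 := FinslerChange.homothetic_of_eq_zero (n := n) h0
  exact ⟨key hσ0, fun hd =>
    ⟨FinslerChange.cartanParallel_of_differenceVanishes hU hL hb hf hΩ hL' h0 hd, key hσ0⟩⟩
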